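/- Smooth heaps and slim heaps maintain a collection of node-disjoint heaps whose nodes have real keys. A heap is a list of heap-ordered rooted ordered trees whose lists of roots are accessed through a root of minimum key (the min-root), which comes first. A \emph{link} of two adjacent nodes makes the node of larger key (the left one if the keys are equal) a child of the other: its leftmost child in a slim heap (one-sided linking); its leftmost or rightmost child, according to whether it was on the left or on the right of the winner, in a smooth heap (stable linking). \emph{Leftmost locally maximum linking} of a list of roots repeatedly links the leftmost root whose key is no less than those of its neighbours with the neighbour of larger key (the left one in case of a tie), until one root remains. Besides its list of roots, each heap has a \emph{buffer} of roots; to empty the buffer, its roots are sorted in non-increasing order by key and linked by leftmost locally maximum linking, and the remaining root is added to the list of roots. The operations are: \emph{make-heap} (create an empty heap); \emph{find-min} (return the min-root); \emph{insert} (add a one-node tree to the list of roots); \emph{meld} (empty the buffer of the smaller heap, catenate the lists of roots, keep the buffer of the larger heap); \emph{delete-min} (empty the buffer, replace the min-root by its list of children, and apply leftmost locally maximum linking to the list of roots); \emph{decrease-key} (set the key of the given node $x$ to the new key; if $x$ is not a root, cut it from its siblings, leaving its leftmost child, if any, with its subtree in its place, and add $x$ to the buffer, which is then emptied if it contains at least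 $\lg n$ roots); and \emph{delete} (if the given node is not the min-root, decrease its key to $-\infty$; then do a delete-min). Time is measured by the number of key comparisons and elementary list and link operations. Theorem. In a smooth heap and in a slim heap, starting from an empty collection of heaps, \emph{delete-min} and \emph{delete} take $O(\lg n)$ amortized time, \emph{decrease-key} takes $O(\lg\lg n)$ amortized time, and \emph{make-heap}, \emph{find-min}, \emph{insert} and \emph{meld} take $O(1)$ amortized time (for \emph{make-heap}, \emph{find-min} and \emph{insert}, also in the worst case), where $n$ is the number of nodes in the heap at the time of the operation, and $\lg n$ and $\lg\lg n$ are replaced by $1$ if $n<4$. That is, there are an absolute constant $C$ and, for each of the two kinds of heap, a potential $\Phi$ on the states of the collection, zero on the empty collection and non-negative on every state that a sequence of operations can produce, such that for every operation the actual time plus the increase of $\Phi$ is at most $C$ times the stated bound; consequently the total actual time of any sequence of operations, starting from the empty collection, is at most $C$ times the sum of the stated bounds. -/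

import Mathlib

/-!
Smooth heaps and slim heaps: the data structure, its operations with an explicit step count,
and sequences of operations on a collection of heaps.
-/

namespace SelfAdjustingHeap

/-! ### Step counting -/

/-- A computation with result `val` that takes `time` elementary steps. -/
structure Timed (α : Type) where
  val : α
  time : ℕ

instance : Monad Timed where
  pure a := ⟨a, 0⟩
  bind m f := ⟨(f m.val).val, m.time + (f m.val).time⟩

/-- Spend `c` elementary steps. An elementary step is a key comparison or an update of a bounded
number of pointers and fields, as in: making one node the leftmost or rightmost child of another,
inserting a node at the front of a list (or right after the front), removing or replacing a node
(given by a pointer) in a list, catenating two circular lists, moving the access pointer of a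
circular list. -/
def spend (c : ℕ) : Timed Unit := ⟨(), c⟩

/-! ### Trees and links -/

/-- The two kinds of heap: slim heaps use one-sided links, smooth heaps use stable links. -/
inductive Kind where
  | slim
  | smooth

/-- A rooted ordered tree. A node is identified by its name `id` (playing the role of a pointer to
it); it has a key and a list of children, from left to right. The key `⊥` is minus infinity; it is
only used temporarily, inside a deletion. -/
inductive HTree (K : Type) where
  | node (id : ℕ) (key : WithBot K) (children : List (HTree K)) : HTree K

namespace HTree

variable {K : Type}

def id : HTree K → ℕ
  | node i _ _ => i

def key : HTree K → WithBot K
  | node _ k _ => k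

def children : HTree K → List (HTree K)
  | node _ _ cs => cs

def setKey : HTree K → WithBot K → HTree K
  | node i _ cs, k => node i k cs

/-- `t.addLeft c` makes `c` the new leftmost child of the root of `t`. -/
def addLeft : HTree K → HTree K → HTree K
  | node i k cs, c => node i k (c :: cs)

/-- `t.addRight c` makes `c` the new rightmost child of the root of `t`. -/
def addRight : HTree K → HTree K → HTree K
  | node i k cs, c => node i k (cs ++ [c])

mutual
/-- The nodes of a tree, with their keys. -/
def entries : HTree K → List (ℕ × WithBot K)
  | node i k cs => (i, k) :: entriesList cs

/-- The nodes of a list of trees, with their keys. -/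
def entriesList : List (HTree K) → List (ℕ × WithBot K)
  | [] => []
  | t :: ts => entries t ++ entriesList ts
end

mutual
/-- Find the node `x` among the proper descendants of the root, and cut it out. See `cutList`. -/
def cutBelow (x : ℕ) : HTree K → Option (HTree K × HTree K)
  | node i k cs =>
    match cutList x cs with
    | some (t, cs') => some (t, node i k cs')
    | none => none

/-- Find the node `x` in a list of trees. Cut `x` (with its subtree) from its list of siblings; if
`x` has a child, cut the leftmost child `y` of `x` (with its subtree) from `x` and put `y` in the
place of `x`. Return the tree of `x`, without `y`, and the list of trees after the cut. (The search
is only there because the model has no pointers.) -/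
def cutList (x : ℕ) : List (HTree K) → Option (HTree K × List (HTree K))
  | [] => none
  | c :: cs =>
    if c.id = x then
      match c with
      | node i k [] => some (node i k [], cs)
      | node i k (y :: ys) => some (node i k ys, y :: cs)
    else
      match cutBelow x c with
      | some (t, c') => some (t, c' :: cs)
      | none =>
        match cutList x cs with
        | some (t, cs') => some (t, c :: cs')
        | none => none
end

end HTree

variable {K : Type} [LinearOrder K]

/-- Link two adjacent nodes, `u` on the left and `v` on the right. The node of smaller key wins and
becomes the parent of the other; if the keys are equal, the node on the right wins. The loser
becomes the leftmost child of the winner, except that with stable linking it becomes the rightmost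
child if it was on the right of the winner. -/
def link (kind : Kind) (u v : HTree K) : Timed (HTree K) := do
  spend 2
  if u.key < v.key then
    match kind with
    | .slim => pure (u.addLeft v)
    | .smooth => pure (u.addRight v)
  else
    pure (v.addLeft u)

/-- Leftmost locally maximum linking, in the middle of its execution: `v` is the current root, the
first argument holds the roots preceding it, from right to left, and the last argument the roots
following it, from left to right. Proceed rightward until `v` has key no less than that of its right
neighbour `w`; then link `v` with whichever neighbour has larger key (the left one in case of a tie,
the right one if there is no left one) and continue from the winner. If `v` is the rightmost root,
link the two rightmost roots. -/
def linkFrom (kind : Kind) : List (HTree K) → HTree K → List (HTree K) → Timed (HTree K)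
  | [], v, [] => pure v
  | u :: L, v, [] => do
    let t ← link kind u v
    linkFrom kind L t []
  | [], v, w :: R => do
    spend 1
    if v.key < w.key then
      linkFrom kind [v] w R
    else
      let t ← link kind v w
      linkFrom kind [] t R
  | u :: L, v, w :: R => do
    spend 1
    if v.key < w.key then
      linkFrom kind (v :: u :: L) w R
    else
      spend 1
      if w.key ≤ u.key then
        let t ← link kind u v
        linkFrom kind L t (w :: R)
      else
        let t ← link kind v w
        linkFrom kind (u :: L) t R
termination_by L _ R => L.length + 2 * R.length

/-- Leftmost locally maximum linking of a list of roots, until at most one root remains. -/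
def linkAll (kind : Kind) : List (HTree K) → Timed (List (HTree K))
  | [] => pure []
  | v :: R => do
    let t ← linkFrom kind [] v R
    pure [t]

/-! ### Sorting (for emptying the buffer) -/

/-- Merge two lists in non-increasing order of keys; equal keys are taken from the first list. -/
def merge : List (HTree K) → List (HTree K) → Timed (List (HTree K))
  | [], ys => pure ys
  | x :: xs, [] => pure (x :: xs)
  | x :: xs, y :: ys => do
    spend 1
    if y.key ≤ x.key then
      let zs ← merge xs (y :: ys)
      pure (x :: zs)
    else
      let zs ← merge (x :: xs) ys
      pure (y :: zs)
termination_by xs ys => xs.length + ys.length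

/-- Stable merge sort, in non-increasing order of keys. -/
def mergeSort : List (HTree K) → Timed (List (HTree K))
  | [] => pure []
  | [a] => pure [a]
  | a :: b :: l => do
    spend (l.length + 2)
    let xs ← mergeSort ((a :: b :: l).take ((l.length + 2) / 2))
    let ys ← mergeSort ((a :: b :: l).drop ((l.length + 2) / 2))
    merge xs ys
termination_by l => l.length
decreasing_by
  · simp only [List.length_take, List.length_cons]; omega
  · simp only [List.length_drop, List.length_cons]; omega

/-! ### Heaps -/

/-- A smooth heap or slim heap: the list of roots, and the buffer of roots whose keys have been
decreased. Both lists are circular and are accessed through a root of minimum key in the list (its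
min-root), which comes first. -/
structure Heap (K : Type) where
  roots : List (HTree K)
  buffer : List (HTree K)

/-- Insert a root into a circular list of roots with the min-root first: in first position if its
key is less than that of the min-root (it becomes the min-root), else in second position. -/
def insertRoot (t : HTree K) : List (HTree K) → Timed (List (HTree K))
  | [] => do
    spend 1
    pure [t]
  | m :: l => do
    spend 2
    if t.key < m.key then pure (t :: m :: l) else pure (m :: t :: l)

/-- Catenate two circular lists of roots; the min-root of smaller key becomes the first root. -/
def catRoots : List (HTree K) → List (HTree K) → Timed (List (HTree K))
  | [], l' => do
    spend 1
    pure l'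
  | m :: l, [] => do
    spend 1
    pure (m :: l)
  | m :: l, m' :: l' => do
    spend 2
    if m'.key < m.key then pure (m' :: l' ++ m :: l) else pure (m :: l ++ m' :: l')

/-- Decrease to `k` the key of the root `x` of a circular list, and make `x` the first root if its
key is now less than that of the min-root. -/
def lowerRoot (x : ℕ) (k : WithBot K) (l : List (HTree K)) : Timed (List (HTree K)) := do
  spend 2
  let l' := l.map fun t => if t.id = x then t.setKey k else t
  match l' with
  | [] => pure []
  | m :: _ =>
    if k < m.key then pure (l'.rotate (l'.findIdx fun t => t.id == x)) else pure l'

namespace Heap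

/-- The nodes of the heap, with their keys. -/
def entries {K : Type} (H : Heap K) : List (ℕ × WithBot K) :=
  HTree.entriesList H.roots ++ HTree.entriesList H.buffer

/-- The number of nodes in the heap. -/
def size {K : Type} (H : Heap K) : ℕ := H.entries.length

/-- A new, empty heap. -/
def make (K : Type) : Timed (Heap K) := do
  spend 1
  pure ⟨[], []⟩

/-- The node of minimum key: the min-root of the list of roots or the min-root of the buffer. -/
def findMin (H : Heap K) : Timed (Option ℕ) := do
  spend 1
  match H.roots, H.buffer with
  | [], [] => pure none
  | m :: _, [] => pure (some m.id)
  | [], b :: _ => pure (some b.id)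
  | m :: _, b :: _ => do
    spend 1
    if b.key < m.key then pure (some b.id) else pure (some m.id)

/-- Insert the new node `x` with key `k`, as a one-node tree. -/
def insert (x : ℕ) (k : K) (H : Heap K) : Timed (Heap K) := do
  spend 1
  let rs ← insertRoot (.node x k []) H.roots
  pure { H with roots := rs }

/-- Empty the buffer: sort the roots in it in non-increasing order by key (starting from the order
in which its min-root comes last), link them by leftmost locally maximum linking, and add the
remaining root to the list of roots. -/
def emptyBuffer (kind : Kind) (H : Heap K) : Timed (Heap K) :=
  match H.buffer with
  | [] => pure H
  | b :: bs => do
    spend 1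
    let sorted ← mergeSort (bs ++ [b])
    match sorted with
    | [] => pure ⟨H.roots, []⟩
    | v :: R => do
      let t ← linkFrom kind [] v R
      let rs ← insertRoot t H.roots
      pure ⟨rs, []⟩

/-- Empty the buffer, delete the min-root, replace it in the list of roots by its children, and link
the roots by leftmost locally maximum linking. -/
def deleteMin (kind : Kind) (H : Heap K) : Timed (Heap K) := do
  spend 1
  let H₁ ← emptyBuffer kind H
  match H₁.roots with
  | [] => pure H₁
  | m :: rs => do
    spend 1
    let rs' ← linkAll kind (m.children ++ rs)
    pure ⟨rs', H₁.buffer⟩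

/-- Empty the buffer of the smaller heap and catenate the lists of roots; the buffer of the larger
heap becomes the buffer of the new heap. -/
def meld (kind : Kind) (H H' : Heap K) : Timed (Heap K) := do
  spend 1
  if H'.size ≤ H.size then
    let G ← emptyBuffer kind H'
    let rs ← catRoots H.roots G.roots
    pure ⟨rs, H.buffer⟩
  else
    let G ← emptyBuffer kind H
    let rs ← catRoots G.roots H'.roots
    pure ⟨rs, H'.buffer⟩

/-- Cut the non-root node `x` out of the tree containing it, see `HTree.cutList`. -/
def cut {K : Type} (x : ℕ) (H : Heap K) : Option (HTree K × Heap K) :=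
  match HTree.cutList x H.roots with
  | some (t, rs) => some (t, ⟨rs, H.buffer⟩)
  | none =>
    match HTree.cutList x H.buffer with
    | some (t, bs) => some (t, ⟨H.roots, bs⟩)
    | none => none

/-- Decrease the key of the node `x` to `k`. If `x` is not a root, cut it out, leaving its leftmost
child (if any) in its place, and add it to the buffer; if the buffer then contains at least `lg n`
roots, where `n` is the number of nodes in the heap, empty it. -/
def decreaseKey (kind : Kind) (x : ℕ) (k : WithBot K) (H : Heap K) : Timed (Heap K) := do
  spend 1
  if x ∈ H.roots.map HTree.id then
    let rs ← lowerRoot x k H.roots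
    pure { H with roots := rs }
  else if x ∈ H.buffer.map HTree.id then
    let bs ← lowerRoot x k H.buffer
    pure { H with buffer := bs }
  else
    match H.cut x with
    | none => pure H
    | some (t, H₁) => do
      spend 3
      let bs ← insertRoot (t.setKey k) H₁.buffer
      -- `n ≤ 2 ^ b` says that `lg n ≤ b`
      if H.size ≤ 2 ^ bs.length then
        emptyBuffer kind ⟨H₁.roots, bs⟩
      else
        pure ⟨H₁.roots, bs⟩

/-- Delete the node `x`: if it is the node of minimum key that `findMin` returns, do `deleteMin`,
else decrease its key to minus infinity and do `deleteMin`. -/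
def delete (kind : Kind) (x : ℕ) (H : Heap K) : Timed (Heap K) := do
  let m ← H.findMin
  if m = some x then
    H.deleteMin kind
  else
    let H₁ ← H.decreaseKey kind x ⊥
    H₁.deleteMin kind

end Heap

/-! ### Collections of heaps and sequences of operations -/

/-- A collection of heaps; `none` marks a name that is not the name of a heap at present. -/
abbrev State (K : Type) : Type := ℕ → Option (Heap K)

/-- The empty collection. -/
def State.init (K : Type) : State K := fun _ => none

/-- The number of nodes in the heap named `h`. -/
def State.size {K : Type} (s : State K) (h : ℕ) : ℕ :=
  match s h with
  | none => 0
  | some H => H.size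

/-- The heap operations; `h` and `h'` are names of heaps, `x` is a node and `k` a key. -/
inductive Op (K : Type) where
  | makeHeap (h : ℕ)
  | findMin (h : ℕ)
  | insert (x : ℕ) (k : K) (h : ℕ)
  | deleteMin (h : ℕ)
  | meld (h h' : ℕ)
  | decreaseKey (x : ℕ) (k : K) (h : ℕ)
  | delete (x : ℕ) (h : ℕ)

/-- `Step kind s op t s'`: the operation `op` is allowed in the state `s`, it takes actual time `t`,
and it leads to the state `s'`. -/
inductive Step (kind : Kind) : State K → Op K → ℕ → State K → Prop
  | makeHeap (s : State K) (h : ℕ) (hh : s h = none) :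
      Step kind s (.makeHeap h) (Heap.make K).time
        (Function.update s h (some (Heap.make K).val))
  | findMin (s : State K) (h : ℕ) (H : Heap K) (hh : s h = some H) :
      Step kind s (.findMin h) H.findMin.time s
  | insert (s : State K) (x : ℕ) (k : K) (h : ℕ) (H : Heap K) (hh : s h = some H)
      (hx : ∀ g G, s g = some G → ∀ c, (x, c) ∉ G.entries) :
      Step kind s (.insert x k h) (H.insert x k).time
        (Function.update s h (some (H.insert x k).val))
  | deleteMin (s : State K) (h : ℕ) (H : Heap K) (hh : s h = some H) :
      Step kind s (.deleteMin h) (H.deleteMin kind).time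
        (Function.update s h (some (H.deleteMin kind).val))
  | meld (s : State K) (h h' : ℕ) (H H' : Heap K) (hne : h ≠ h') (hh : s h = some H)
      (hh' : s h' = some H') :
      Step kind s (.meld h h') (H.meld kind H').time
        (Function.update (Function.update s h' none) h (some (H.meld kind H').val))
  | decreaseKey (s : State K) (x : ℕ) (k : K) (h : ℕ) (H : Heap K) (hh : s h = some H)
      (c : WithBot K) (hx : (x, c) ∈ H.entries) (hk : (k : WithBot K) ≤ c) :
      Step kind s (.decreaseKey x k h) (H.decreaseKey kind x k).time
        (Function.update s h (some (H.decreaseKey kind x k).val))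
  | delete (s : State K) (x : ℕ) (h : ℕ) (H : Heap K) (hh : s h = some H)
      (c : WithBot K) (hx : (x, c) ∈ H.entries) :
      Step kind s (.delete x h) (H.delete kind x).time
        (Function.update s h (some (H.delete kind x).val))

/-- `lg n` for `n ≥ 4`, and `1` for `n < 4`. -/
noncomputable def lgBound (n : ℕ) : ℝ := if n < 4 then 1 else Real.logb 2 n

/-- `lg lg n` for `n ≥ 4`, and `1` for `n < 4`. -/
noncomputable def lglgBound (n : ℕ) : ℝ := if n < 4 then 1 else Real.logb 2 (Real.logb 2 n)

/-- The amortized bound, up to a constant factor, for an operation performed in the state `s`. -/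
noncomputable def Op.bound {K : Type} (s : State K) : Op K → ℝ
  | .makeHeap _ => 1
  | .findMin _ => 1
  | .insert _ _ _ => 1
  | .deleteMin h => lgBound (s.size h)
  | .meld _ _ => 1
  | .decreaseKey _ _ h => lglgBound (s.size h)
  | .delete _ h => lgBound (s.size h)

/-- `Run kind s T B`: some sequence of operations, starting from the empty collection, leads to the
state `s`; `T` is the sum of the actual times of its operations, and `B` is the sum of their
bounds. -/
inductive Run (kind : Kind) : State K → ℕ → ℝ → Prop
  | nil : Run kind (State.init K) 0 0
  | snoc (s : State K) (T : ℕ) (B : ℝ) (op : Op K) (t : ℕ) (s' : State K)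
      (hrun : Run kind s T B) (hstep : Step kind s op t s') :
      Run kind s' (T + t) (B + op.bound s)

/-- The states that sequences of operations lead to. -/
def Reachable (kind : Kind) (s : State K) : Prop := ∃ T B, Run kind s T B

end SelfAdjustingHeap

open SelfAdjustingHeap

namespace SelfAdjustingHeap

/-! ### Timed computations -/

namespace Timed

variable {α β : Type}

@[simp] theorem val_pure (a : α) : (pure a : Timed α).val = a := rfl

@[simp] theorem time_pure (a : α) : (pure a : Timed α).time = 0 := rfl

@[simp] theorem val_bind (m : Timed α) (f : α → Timed β) : (m >>= f).val = (f m.val).val := rfl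

@[simp] theorem time_bind (m : Timed α) (f : α → Timed β) :
    (m >>= f).time = m.time + (f m.val).time := rfl

end Timed

@[simp] theorem time_spend (c : ℕ) : (spend c).time = c := rfl

/-! ### Binary trees -/

/-- Binary trees with labelled nodes. -/
inductive BinTree (α : Type) where
  | nil
  | node (l : BinTree α) (a : α) (r : BinTree α)

namespace BinTree

variable {α : Type}

/-- The labels in symmetric order. -/
def inorder : BinTree α → List α
  | nil => []
  | node l a r => l.inorder ++ a :: r.inorder

/-- `0` for the empty tree and `1` for a nonempty one. -/
def indicator : BinTree α → ℕ
  | nil => 0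
  | node _ _ _ => 1

/-- The numbers of children of the nodes, in symmetric order. -/
def degrees : BinTree α → List ℕ
  | nil => []
  | node l _ r => l.degrees ++ (l.indicator + r.indicator) :: r.degrees

theorem indicator_le_one (t : BinTree α) : t.indicator ≤ 1 := by
  cases t <;> simp [indicator]

theorem length_degrees (t : BinTree α) : t.degrees.length = t.inorder.length := by
  induction t with
  | nil => rfl
  | node l a r hl hr => simp [degrees, inorder, hl, hr]

theorem degrees_le_two (t : BinTree α) : ∀ d ∈ t.degrees, d ≤ 2 := by
  induction t with
  | nil => simp [degrees]
  | node l a r hl hr =>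
    intro d hd
    simp only [degrees, List.mem_append, List.mem_cons] at hd
    have := l.indicator_le_one
    have := r.indicator_le_one
    rcases hd with h | rfl | h
    · exact hl d h
    · omega
    · exact hr d h

/-- Every node except the root is counted once, by its parent. -/
theorem sum_degrees (t : BinTree α) : t.degrees.sum + t.indicator = t.degrees.length := by
  induction t with
  | nil => rfl
  | node l a r hl hr =>
    have : (node l a r).indicator = 1 := rfl
    simp only [degrees, this, List.sum_append, List.sum_cons, List.length_append,
      List.length_cons]
    omega

/-- A nonempty left subtree sums to one less than its length, which pays for the link to it; the
place of the root itself pays for the link to the right subtree. -/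
theorem sum_degrees_prefix (t : BinTree α) :
    ∀ u v, t.degrees = u ++ v → u.sum ≤ u.length := by
  induction t with
  | nil =>
    intro u v h
    simp [degrees] at h
    simp [h.1]
  | node l a r hl hr =>
    intro u v h
    have h1 := l.sum_degrees
    have := l.indicator_le_one
    have := r.indicator_le_one
    rw [degrees, List.append_eq_append_iff] at h
    rcases h with ⟨w, rfl, h⟩ | ⟨w, h, -⟩
    · rcases w with _ | ⟨d, w⟩
      · simp only [List.append_nil]; omega
      · simp only [List.cons_append, List.cons.injEq] at h
        have := hr w v h.2
        simp only [List.sum_append, List.sum_cons, List.length_append, List.length_cons]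
        omega
    · exact hl u w h

theorem sum_degrees_suffix (t : BinTree α) :
    ∀ u v, t.degrees = u ++ v → v.sum ≤ v.length := by
  induction t with
  | nil =>
    intro u v h
    simp [degrees] at h
    simp [h.2]
  | node l a r hl hr =>
    intro u v h
    have h1 := r.sum_degrees
    have := l.indicator_le_one
    have := r.indicator_le_one
    rw [degrees, List.append_eq_append_iff] at h
    rcases h with ⟨w, rfl, h⟩ | ⟨w, h, rfl⟩
    · rcases w with _ | ⟨d, w⟩
      · simp only [List.nil_append] at h
        subst h
        simp only [List.sum_cons, List.length_cons]; omega
      · simp only [List.cons_append, List.cons.injEq] at h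
        exact hr w v h.2
    · have := hl u w h
      simp only [List.sum_append, List.sum_cons, List.length_append, List.length_cons]
      omega

end BinTree

/-! ### Linking as building a heap-ordered tree from a binary tree -/

namespace HTree

variable {K : Type}

@[simp] theorem key_addLeft (t c : HTree K) : (t.addLeft c).key = t.key := by
  cases t; rfl

@[simp] theorem key_addRight (t c : HTree K) : (t.addRight c).key = t.key := by
  cases t; rfl

/-- Add an optional child that was on the left of the winner. -/
def addLeft? : Option (HTree K) → HTree K → HTree K
  | none, t => t
  | some c, t => t.addLeft c

/-- Add an optional child that was on the right of the winner. -/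
def addRight? (kind : Kind) : Option (HTree K) → HTree K → HTree K
  | none, t => t
  | some c, t =>
    match kind with
    | .slim => t.addLeft c
    | .smooth => t.addRight c

@[simp] theorem key_addLeft? (c : Option (HTree K)) (t : HTree K) : (addLeft? c t).key = t.key := by
  cases c <;> simp [addLeft?]

@[simp] theorem key_addRight? (kind : Kind) (c : Option (HTree K)) (t : HTree K) :
    (addRight? kind c t).key = t.key := by
  cases c <;> cases kind <;> simp [addRight?]

end HTree

open HTree

/-- Link all roots that label a binary tree, following the shape of the binary tree. -/
def BinTree.build {K : Type} (kind : Kind) : BinTree (HTree K) → Option (HTree K)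
  | .nil => none
  | .node l p r => some (addRight? kind (r.build kind) (addLeft? (l.build kind) p))

variable {K : Type}

/-- A tree in the middle of leftmost locally maximum linking: the node `p.2` with its left child. -/
def halfBuilt (kind : Kind) (p : BinTree (HTree K) × HTree K) : HTree K :=
  addLeft? (p.1.build kind) p.2

@[simp] theorem key_halfBuilt (kind : Kind) (p : BinTree (HTree K) × HTree K) :
    (halfBuilt kind p).key = p.2.key := by
  simp [halfBuilt]

variable [LinearOrder K]

theorem time_link (kind : Kind) (u v : HTree K) : (link kind u v).time = 2 := by
  simp only [link, Timed.time_bind, time_spend]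
  split_ifs <;> cases kind <;> simp

theorem val_link_of_lt (kind : Kind) {u v : HTree K} (h : u.key < v.key) :
    (link kind u v).val = addRight? kind (some v) u := by
  cases kind <;> simp [link, h, addRight?]

theorem val_link_of_le (kind : Kind) {u v : HTree K} (h : v.key ≤ u.key) :
    (link kind u v).val = addLeft? (some u) v := by
  simp [link, not_lt.2 h, addLeft?]

/-- Moving right, linking with the left and linking with the right each lower `L.length + 2 *
R.length` by at least one and cost at most 4. -/
theorem time_linkFrom_le (kind : Kind) (L : List (HTree K)) (v : HTree K) (R : List (HTree K)) :
    (linkFrom kind L v R).time ≤ 4 * (L.length + 2 * R.length) := by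
  induction L, v, R using linkFrom.induct with
  | case1 v => simp [linkFrom]
  | case2 u L v ih =>
    have := ih (link kind u v).val
    simp only [linkFrom, Timed.time_bind, time_link, List.length_cons, List.length_nil] at this ⊢
    omega
  | case3 v w R ih₁ ih₂ =>
    have := ih₂ (link kind v w).val
    rw [linkFrom]
    split_ifs
    all_goals
      simp only [Timed.time_bind, time_spend, time_link, List.length_cons] at *
      omega
  | case4 u L v w R ih₁ ih₂ ih₃ =>
    have := ih₂ (link kind u v).val
    have := ih₃ (link kind v w).val
    rw [linkFrom]
    split_ifs
    all_goals
      simp only [Timed.time_bind, time_spend, time_link, List.length_cons] at *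
      omega

/-- Leftmost locally maximum linking links the roots along some binary tree whose symmetric order is
the order of the roots. In the middle of the execution the preceding roots have strictly increasing
keys and have not won a link on the right, and the current root has not won one on the right unless
it is going to lose the next link. -/
theorem exists_build_eq_linkFrom (kind : Kind) (n : ℕ) :
    ∀ (L : List (BinTree (HTree K) × HTree K)) (l : BinTree (HTree K)) (p : HTree K)
      (r : BinTree (HTree K)) (R : List (HTree K)), L.length + 2 * R.length = n →
      (∀ u ∈ L.head?, u.2.key < p.key) → L.IsChain (fun a b => b.2.key < a.2.key) →
      (r ≠ .nil → ∀ w ∈ R.head?, w.key ≤ p.key) →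
      ∃ t : BinTree (HTree K),
        t.build kind = some (linkFrom kind (L.map (halfBuilt kind))
          (addRight? kind (r.build kind) (halfBuilt kind (l, p))) R).val ∧
        t.inorder = L.reverse.flatMap (fun a => a.1.inorder ++ [a.2]) ++
          (BinTree.node l p r).inorder ++ R := by
  induction n using Nat.strong_induction_on with
  | _ n ih =>
  intro L l p r R hn hL hc hr
  have hbuild : (BinTree.node l p r).build kind =
      some (addRight? kind (r.build kind) (halfBuilt kind (l, p))) := rfl
  set v := addRight? kind (r.build kind) (halfBuilt kind (l, p)) with hv
  have hvk : v.key = p.key := by simp [hv]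
  rcases L with _ | ⟨⟨lu, u⟩, L⟩ <;> rcases R with _ | ⟨w, R⟩
  · exact ⟨.node l p r, by simp [linkFrom, hbuild], by simp⟩
  · simp only [List.map_nil]
    rw [linkFrom]
    by_cases hvw : v.key < w.key
    · have hrn : r = .nil := by
        by_contra h
        exact absurd (hr h w (by simp)) (not_le.2 (hvk ▸ hvw))
      subst hrn
      obtain ⟨t, ht, ht'⟩ := ih (1 + 2 * R.length) (by simp at hn; omega) [(l, p)] .nil w .nil R
        (by simp) (by simpa [← hvk] using hvw) (by simp) (by simp)
      refine ⟨t, ?_, ?_⟩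
      · rw [if_pos hvw]
        simpa [BinTree.build, addRight?, halfBuilt, addLeft?, hv] using ht
      · simpa [BinTree.inorder] using ht'
    · obtain ⟨t, ht, ht'⟩ := ih (2 * R.length) (by simp at hn; omega) [] (.node l p r) w .nil R
        (by simp) (by simp) (by simp) (by simp)
      refine ⟨t, ?_, ?_⟩
      · simpa [hvw, BinTree.build.eq_1, addRight?, halfBuilt, hbuild,
          val_link_of_le kind (not_lt.1 hvw)] using ht
      · simpa [BinTree.inorder] using ht'
  · have huv : (halfBuilt kind (lu, u)).key < v.key := by simpa [hvk] using hL
    simp only [List.map_cons]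
    rw [linkFrom]
    obtain ⟨t, ht, ht'⟩ := ih L.length (by simp at hn; omega) L lu u (.node l p r) []
      (by simp) (by cases L <;> simp_all) hc.tail (by simp)
    refine ⟨t, ?_, ?_⟩
    · simpa [val_link_of_lt kind huv, hbuild] using ht
    · simpa [BinTree.inorder] using ht'
  · have huv : (halfBuilt kind (lu, u)).key < v.key := by simpa [hvk] using hL
    simp only [List.map_cons]
    rw [linkFrom]
    by_cases hvw : v.key < w.key
    · have hrn : r = .nil := by
        by_contra h
        exact absurd (hr h w (by simp)) (not_le.2 (hvk ▸ hvw))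
      subst hrn
      obtain ⟨t, ht, ht'⟩ := ih (L.length + 2 + 2 * R.length) (by simp at hn; omega)
        ((l, p) :: (lu, u) :: L) .nil w .nil R
        (by simp) (by simpa [← hvk] using hvw) (by simp_all) (by simp)
      refine ⟨t, ?_, ?_⟩
      · rw [if_pos hvw]
        simpa [BinTree.build, addRight?, halfBuilt, addLeft?, hv] using ht
      · simpa [BinTree.inorder] using ht'
    · by_cases hwu : w.key ≤ (halfBuilt kind (lu, u)).key
      -- `hwu` is the promise that `u`, which now has a right child, loses its next link.
      · obtain ⟨t, ht, ht'⟩ := ih (L.length + 2 * (R.length + 1)) (by simp at hn; omega)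
          L lu u (.node l p r) (w :: R)
          (by simp) (by cases L <;> simp_all) hc.tail (by simpa using hwu)
        refine ⟨t, ?_, ?_⟩
        · rw [if_neg hvw]
          simp only [Timed.val_bind, if_pos hwu]
          simpa [val_link_of_lt kind huv, hbuild] using ht
        · simpa [BinTree.inorder] using ht'
      · obtain ⟨t, ht, ht'⟩ := ih (L.length + 1 + 2 * R.length) (by simp at hn; omega)
          ((lu, u) :: L) (.node l p r) w .nil R
          (by simp) (by simpa using hwu) hc (by simp)
        refine ⟨t, ?_, ?_⟩
        · rw [if_neg hvw]
          simp only [Timed.val_bind, if_neg hwu]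
          simpa [BinTree.build.eq_1, addRight?, halfBuilt, hbuild,
            val_link_of_le kind (not_lt.1 hvw)] using ht
        · simpa [BinTree.inorder] using ht'

theorem exists_build_eq_linkFrom_nil (kind : Kind) (v : HTree K) (R : List (HTree K)) :
    ∃ t : BinTree (HTree K), t.build kind = some (linkFrom kind [] v R).val ∧
      t.inorder = v :: R := by
  simpa [BinTree.build, halfBuilt, addLeft?, addRight?, BinTree.inorder] using
    exists_build_eq_linkFrom kind _ [] .nil v .nil R rfl (by simp) (by simp) (by simp)

end SelfAdjustingHeap

namespace SelfAdjustingHeap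

/-! ### Potentials of lists of weights -/

/-- The binary logarithm of a natural number. -/
noncomputable def lg (n : ℕ) : ℝ := Real.logb 2 n

theorem lg_one : lg 1 = 0 := by simp [lg]

theorem lg_two : lg 2 = 1 := by simp [lg]

theorem lg_nonneg (n : ℕ) : 0 ≤ lg n := by
  rcases Nat.eq_zero_or_pos n with rfl | h
  · simp [lg]
  · exact Real.logb_nonneg one_lt_two (by exact_mod_cast h)

theorem lg_mono {m n : ℕ} (h : m ≤ n) : lg m ≤ lg n := by
  rcases Nat.eq_zero_or_pos m with rfl | hm
  · simpa [lg] using lg_nonneg n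
  · exact Real.logb_le_logb_of_le one_lt_two (by exact_mod_cast hm) (by exact_mod_cast h)

theorem lg_mul {m n : ℕ} (hm : 0 < m) (hn : 0 < n) : lg (m * n) = lg m + lg n := by
  rw [lg, Nat.cast_mul, Real.logb_mul (by positivity) (by positivity)]; rfl

theorem lg_two_mul {n : ℕ} (hn : 0 < n) : lg (2 * n) = lg n + 1 := by
  rw [lg_mul two_pos hn, lg_two, add_comm]

/-- One of the two parts of a sum is at most half of the sum. -/
theorem one_add_lg_add_lg_le {a b : ℕ} (ha : 0 < a) (hb : 0 < b) :
    1 + lg a + lg b ≤ 2 * lg (a + b) := by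
  rcases le_total a b with h | h
  · have h1 := lg_mono (show 2 * a ≤ a + b by omega)
    have h2 := lg_mono (show b ≤ a + b by omega)
    rw [lg_two_mul ha] at h1
    linarith
  · have h1 := lg_mono (show 2 * b ≤ a + b by omega)
    have h2 := lg_mono (show a ≤ a + b by omega)
    rw [lg_two_mul hb] at h1
    linarith

/-- `l` arises from `l'` by removing entries and decreasing entries. -/
abbrev Dominated (l l' : List ℕ) : Prop := List.SublistForall₂ (· ≤ ·) l l'

namespace Dominated

theorem of_forall₂ {l l' : List ℕ} (h : List.Forall₂ (· ≤ ·) l l') : Dominated l l' :=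
  List.sublistForall₂_iff.2 ⟨l', h, List.Sublist.refl _⟩

theorem rfl' (l : List ℕ) : Dominated l l :=
  of_forall₂ (List.forall₂_same.2 fun _ _ => le_rfl)

theorem of_sublist {l l' : List ℕ} (h : l.Sublist l') : Dominated l l' :=
  List.sublistForall₂_iff.2 ⟨l, List.forall₂_same.2 fun _ _ => le_rfl, h⟩

theorem tail {l l' : List ℕ} (h : Dominated l l') : Dominated l.tail l'.tail := by
  induction h with
  | nil => exact .nil
  | cons _ h _ => exact h
  | @cons_right b l₁ l₂ h ih =>
    refine List.sublistForall₂_iff.2 ?_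
    obtain ⟨l, hl, hs⟩ := List.sublistForall₂_iff.1 h
    refine ⟨l.tail, ?_, (List.tail_sublist l).trans hs⟩
    cases hl <;> simp_all

theorem reverse {l l' : List ℕ} (h : Dominated l l') : Dominated l.reverse l'.reverse := by
  obtain ⟨m, hl, hs⟩ := List.sublistForall₂_iff.1 h
  exact List.sublistForall₂_iff.2 ⟨m.reverse, List.forall₂_reverse_iff.2 hl, hs.reverse⟩

theorem sum_le {l l' : List ℕ} (h : Dominated l l') : l.sum ≤ l'.sum := by
  induction h with
  | nil => simp
  | cons _ _ ih => simp only [List.sum_cons]; omega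
  | cons_right _ ih => simp only [List.sum_cons]; omega

theorem exists_append {l l' : List ℕ} (h : Dominated l l') :
    ∀ {A B : List ℕ}, l' = A ++ B →
      ∃ A' B', l = A' ++ B' ∧ Dominated A' A ∧ Dominated B' B := by
  induction h with
  | nil => exact fun _ => ⟨[], [], rfl, .nil, .nil⟩
  | @cons a b l₁ l₂ hab h ih =>
    rintro (_ | ⟨c, A⟩) B hAB
    · exact ⟨[], a :: l₁, rfl, .nil, by rw [List.nil_append] at hAB; exact hAB ▸ .cons hab h⟩
    · simp only [List.cons_append, List.cons.injEq] at hAB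
      obtain ⟨A', B', rfl, hA, hB⟩ := ih hAB.2
      exact ⟨a :: A', B', rfl, .cons (hAB.1 ▸ hab) hA, hB⟩
  | @cons_right b l₁ l₂ h ih =>
    rintro (_ | ⟨c, A⟩) B hAB
    · exact ⟨[], l₁, rfl, .nil, by rw [List.nil_append] at hAB; exact hAB ▸ .cons_right h⟩
    · simp only [List.cons_append, List.cons.injEq] at hAB
      obtain ⟨A', B', rfl, hA, hB⟩ := ih hAB.2
      exact ⟨A', B', rfl, .cons_right hA, hB⟩

end Dominated

/-- The sum of the logarithms of the suffix sums (plus one) of a list of weights. -/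
noncomputable def suffixPot : List ℕ → ℝ
  | [] => 0
  | w :: l => lg (1 + w + l.sum) + suffixPot l

theorem suffixPot_nonneg (l : List ℕ) : 0 ≤ suffixPot l := by
  induction l with
  | nil => exact le_rfl
  | cons w l ih => exact add_nonneg (lg_nonneg _) ih

theorem suffixPot_mono {l l' : List ℕ} (h : Dominated l l') : suffixPot l ≤ suffixPot l' := by
  induction h with
  | nil => exact suffixPot_nonneg _
  | cons hab h ih =>
    have := Dominated.sum_le h
    exact add_le_add (lg_mono (by omega)) ih
  | cons_right h ih => exact le_add_of_nonneg_of_le (lg_nonneg _) ih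

theorem suffixPot_le_tail (l : List ℕ) : suffixPot l ≤ suffixPot l.tail + lg (1 + l.sum) := by
  rcases l with _ | ⟨w, l⟩
  · simpa [suffixPot] using lg_nonneg 1
  · simp only [suffixPot, List.tail_cons, List.sum_cons, ← add_assoc]
    exact (add_comm _ _).le

theorem suffixPot_le_drop_two (l : List ℕ) :
    suffixPot l ≤ suffixPot (l.drop 2) + 2 * lg (1 + l.sum) := by
  have h1 := suffixPot_le_tail l
  have h2 := suffixPot_le_tail l.tail
  have h3 := lg_mono (show 1 + l.tail.sum ≤ 1 + l.sum by cases l <;> simp)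
  have h4 : l.tail.tail = l.drop 2 := by simp [← List.drop_one]
  rw [h4] at h2
  linarith

/-- The potential of a list of weights of children for which the first `i` children are those that
were on the left of their parent when they were linked. -/
noncomputable def splitPot (ws : List ℕ) (i : ℕ) : ℝ :=
  suffixPot (ws.take i).tail + suffixPot (ws.drop i).reverse.tail

/-- The potential of a node whose children have given weights. -/
noncomputable def nodePot : Kind → List ℕ → ℝ
  | .slim, ws => suffixPot (ws.drop 2)
  | .smooth, ws =>
    (Finset.range (ws.length + 1)).inf' Finset.nonempty_range_add_one (splitPot ws)

theorem nodePot_smooth_append_le (A B : List ℕ) :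
    nodePot .smooth (A ++ B) ≤ suffixPot A.tail + suffixPot B.reverse.tail := by
  have h : A.length ∈ Finset.range ((A ++ B).length + 1) := by simp
  refine (Finset.inf'_le (splitPot (A ++ B)) h).trans_eq ?_
  rw [splitPot, List.take_left, List.drop_left]

/-- A tree does not record where its left children end, hence the minimum over all boundaries: upper
bounds may choose the split, and paying from the potential uses a split attaining the minimum. -/
theorem exists_nodePot_smooth (ws : List ℕ) :
    ∃ A B, ws = A ++ B ∧ nodePot .smooth ws = suffixPot A.tail + suffixPot B.reverse.tail := by
  obtain ⟨i, -, hi⟩ := Finset.exists_mem_eq_inf'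
    (Finset.nonempty_range_add_one (n := ws.length)) (splitPot ws)
  exact ⟨ws.take i, ws.drop i, by simp, hi⟩

theorem nodePot_nonneg (kind : Kind) (ws : List ℕ) : 0 ≤ nodePot kind ws := by
  cases kind
  · exact suffixPot_nonneg _
  · obtain ⟨A, B, -, h⟩ := exists_nodePot_smooth ws
    rw [h]
    exact add_nonneg (suffixPot_nonneg _) (suffixPot_nonneg _)

theorem nodePot_singleton (kind : Kind) (w : ℕ) : nodePot kind [w] = 0 := by
  cases kind
  · simp [nodePot, suffixPot]
  · refine le_antisymm ?_ (nodePot_nonneg _ _)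
    simpa [suffixPot] using nodePot_smooth_append_le [w] []

/-- In the smooth case an optimal split of the dominating list induces a split of the dominated one.
-/
theorem nodePot_mono (kind : Kind) {ws ws' : List ℕ} (h : Dominated ws ws') :
    nodePot kind ws ≤ nodePot kind ws' := by
  cases kind
  · have := suffixPot_mono h.tail.tail
    simpa [nodePot, ← List.drop_one] using this
  · obtain ⟨A, B, hAB, hp⟩ := exists_nodePot_smooth ws'
    obtain ⟨A', B', rfl, hA, hB⟩ := h.exists_append hAB
    rw [hp]
    exact (nodePot_smooth_append_le A' B').trans
      (add_le_add (suffixPot_mono hA.tail) (suffixPot_mono hB.reverse.tail))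

theorem nodePot_nil (kind : Kind) : nodePot kind [] = 0 :=
  le_antisymm ((nodePot_mono kind (.cons_right .nil)).trans_eq (nodePot_singleton kind 0))
    (nodePot_nonneg _ _)

/-- The potential of a node does not depend on the weight of its leftmost child. -/
theorem nodePot_cons_le (kind : Kind) (v y : ℕ) (ws : List ℕ) :
    nodePot kind (v :: ws) ≤ nodePot kind (y :: ws) := by
  cases kind
  · exact le_rfl
  · obtain ⟨A, B, hAB, hp⟩ := exists_nodePot_smooth (y :: ws)
    rw [hp]
    rcases A with _ | ⟨a, A⟩
    -- If all children are right children, the leftmost weight enters every suffix sum of the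
    -- reversed list. Making that child the only left child exempts it.
    · obtain rfl : B = y :: ws := by simpa using hAB.symm
      refine (nodePot_smooth_append_le [v] ws).trans ?_
      have : Dominated ws.reverse.tail (y :: ws).reverse.tail :=
        (Dominated.of_sublist ((List.sublist_cons_self y ws).reverse)).tail
      simpa [suffixPot] using suffixPot_mono this
    · simp only [List.cons_append, List.cons.injEq] at hAB
      obtain ⟨rfl, rfl⟩ := hAB
      exact nodePot_smooth_append_le (v :: A) B

/-- The new child is exempt; at most one older child loses its exemption, and its suffix sum
involves only old weights. -/
theorem nodePot_cons_le_add (kind : Kind) (a : ℕ) (ws : List ℕ) :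
    nodePot kind (a :: ws) ≤ nodePot kind ws + lg (1 + ws.sum) := by
  cases kind
  · rcases ws with _ | ⟨w, ws⟩
    · simpa [nodePot, suffixPot] using lg_nonneg 1
    · have h := suffixPot_le_tail ws
      have h' := lg_mono (show 1 + ws.sum ≤ 1 + (w :: ws).sum by simp)
      simp only [nodePot, List.drop_succ_cons, List.drop_zero, List.drop_one]
      linarith
  · obtain ⟨A, B, rfl, hp⟩ := exists_nodePot_smooth ws
    have h1 := nodePot_smooth_append_le (a :: A) B
    have h2 := suffixPot_le_tail A
    have h3 := lg_mono (show 1 + A.sum ≤ 1 + (A ++ B).sum by simp)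
    simp only [List.cons_append, List.tail_cons] at h1
    linarith

theorem nodePot_smooth_concat_le (b : ℕ) (ws : List ℕ) :
    nodePot .smooth (ws ++ [b]) ≤ nodePot .smooth ws + lg (1 + ws.sum) := by
  obtain ⟨A, B, rfl, hp⟩ := exists_nodePot_smooth ws
  have h1 := nodePot_smooth_append_le A (B ++ [b])
  have h2 := suffixPot_le_tail B.reverse
  have h3 := lg_mono (show 1 + B.reverse.sum ≤ 1 + (A ++ B).sum by simp)
  simp only [List.reverse_append, List.reverse_singleton, List.singleton_append,
    List.tail_cons, ← List.append_assoc] at h1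
  linarith

theorem nodePot_smooth_cons_concat_le (a b : ℕ) (ws : List ℕ) :
    nodePot .smooth (a :: ws ++ [b]) ≤ nodePot .smooth ws + 2 * lg (1 + ws.sum) := by
  obtain ⟨A, B, rfl, hp⟩ := exists_nodePot_smooth ws
  have h1 := nodePot_smooth_append_le (a :: A) (B ++ [b])
  have h2 := suffixPot_le_tail B.reverse
  have h3 := lg_mono (show 1 + B.reverse.sum ≤ 1 + (A ++ B).sum by simp)
  have h4 := suffixPot_le_tail A
  have h5 := lg_mono (show 1 + A.sum ≤ 1 + (A ++ B).sum by simp)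
  rw [List.reverse_append, List.reverse_singleton, List.singleton_append, List.tail_cons,
    List.tail_cons, ← List.append_assoc, List.cons_append] at h1
  linarith

/-- Two exemptions are needed here because both losers of a round land on the left: their weights
stay out of the potential, and the bound involves only the old size. -/
theorem nodePot_slim_cons_cons_le (a b : ℕ) (ws : List ℕ) :
    nodePot .slim (b :: a :: ws) ≤ nodePot .slim ws + 2 * lg (1 + ws.sum) :=
  suffixPot_le_drop_two ws

/-- The potential of a node nearly pays for the logarithms of the suffix sums of its left children
and the prefix sums of its right children. -/
theorem exists_suffixPot_add_le_nodePot (kind : Kind) (ws : List ℕ) :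
    ∃ A B, ws = A ++ B ∧
      suffixPot A + suffixPot B.reverse ≤ nodePot kind ws + 2 * lg (1 + ws.sum) := by
  cases kind
  · exact ⟨ws, [], by simp, by simpa [suffixPot, nodePot] using suffixPot_le_drop_two ws⟩
  · obtain ⟨A, B, rfl, hp⟩ := exists_nodePot_smooth ws
    refine ⟨A, B, rfl, ?_⟩
    have h2 := suffixPot_le_tail B.reverse
    have h3 := lg_mono (show 1 + B.reverse.sum ≤ 1 + (A ++ B).sum by simp)
    have h4 := suffixPot_le_tail A
    have h5 := lg_mono (show 1 + A.sum ≤ 1 + (A ++ B).sum by simp)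
    linarith

/-! ### The degrees of a binary tree against suffix sums -/

/-- The sum of the terms `d * (lg w + 1)` over corresponding entries of two lists. -/
noncomputable def linkCost : List ℕ → List ℕ → ℝ
  | d :: ds, w :: ws => d * (lg w + 1) + linkCost ds ws
  | _, _ => 0

theorem linkCost_append {ds ws : List ℕ} (h : ds.length = ws.length) (ds' ws' : List ℕ) :
    linkCost (ds ++ ds') (ws ++ ws') = linkCost ds ws + linkCost ds' ws' := by
  induction ds generalizing ws with
  | nil => cases ws <;> simp_all [linkCost]
  | cons d ds ih =>
    rcases ws with _ | ⟨w, ws⟩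
    · simp at h
    · simp [linkCost, ih (Nat.succ.inj h), add_assoc]

theorem linkCost_reverse {ds ws : List ℕ} (h : ds.length = ws.length) :
    linkCost ds.reverse ws.reverse = linkCost ds ws := by
  induction ds generalizing ws with
  | nil => cases ws <;> simp_all [linkCost]
  | cons d ds ih =>
    rcases ws with _ | ⟨w, ws⟩
    · simp at h
    · have h' := Nat.succ.inj h
      rw [List.reverse_cons, List.reverse_cons, linkCost_append (by simpa using h'), ih h']
      simp [linkCost, add_comm]

theorem linkCost_le_of_le_two {ds ws : List ℕ} (hd : ∀ d ∈ ds, d ≤ 2)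
    (h : ds.length = ws.length) :
    linkCost ds ws ≤ (ws.map fun w => 2 * (lg w + 1)).sum := by
  induction ds generalizing ws with
  | nil => cases ws <;> simp_all [linkCost]
  | cons d ds ih =>
    rcases ws with _ | ⟨w, ws⟩
    · simp at h
    · have h1 := ih (fun d hd' => hd d (by simp [hd'])) (Nat.succ.inj h)
      have h2 : (d : ℝ) ≤ 2 := by exact_mod_cast hd d (by simp)
      have h3 := lg_nonneg w
      simp only [linkCost, List.map_cons, List.sum_cons]
      gcongr

/-- Induction from the left, where `e` is the excess that prefixes of the degrees may still have; an
entry `d` turns it into `e + 1 - d`. -/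
theorem linkCost_le_suffixPot {ds ws : List ℕ} (e : ℕ) (hw : ∀ w ∈ ws, 0 < w)
    (hd : ∀ d ∈ ds, d ≤ 2) (h : ds.length = ws.length)
    (hp : ∀ u v, ds = u ++ v → u.sum ≤ u.length + e) :
    linkCost ds ws ≤ suffixPot ws + (e + 2) * lg (1 + ws.sum) := by
  induction ds generalizing ws e with
  | nil =>
    have := suffixPot_nonneg ws
    have := lg_nonneg (1 + ws.sum)
    simp only [linkCost]
    positivity
  | cons d ds ih =>
    rcases ws with _ | ⟨w, ws⟩
    · simp at h
    · have h0 : d ≤ e + 1 := by simpa [add_comm] using hp [d] ds rfl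
      obtain ⟨e', he'⟩ := Nat.exists_eq_add_of_le h0
      have h1 := ih e' (fun w hw' => hw w (by simp [hw'])) (fun d hd' => hd d (by simp [hd']))
        (Nat.succ.inj h) (fun u v huv => by
          have := hp (d :: u) v (by simp [huv])
          simp only [List.sum_cons, List.length_cons] at this
          omega)
      have h2 : (d : ℝ) ≤ 2 := by exact_mod_cast hd d (by simp)
      have h3 : (e : ℝ) + 1 = d + e' := by exact_mod_cast he'
      -- With S' = 1 + `ws.sum` and S = w + S', this bounds d (lg w + 1) by d (2 lg S - lg S').
      have h4 := one_add_lg_add_lg_le (hw w (by simp)) (show 0 < 1 + ws.sum by omega)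
      have h5 := lg_mono (show 1 + ws.sum ≤ w + (1 + ws.sum) by omega)
      have h6 : 1 + (w :: ws).sum = w + (1 + ws.sum) := by simp; omega
      have h7 : 1 + w + ws.sum = w + (1 + ws.sum) := by omega
      simp only [linkCost, suffixPot]
      rw [h6, h7]
      have h8 := mul_le_mul_of_nonneg_left h4 (Nat.cast_nonneg (α := ℝ) d)
      have h9 := lg_nonneg w
      have h10 : (e' : ℝ) = e + 1 - d := by linarith
      rw [h10] at h1
      -- This is e' + 2 - d, the coefficient of lg S - lg S' that remains after all terms are
      -- collected.
      have h11 : 0 ≤ (e + 3 - 2 * (d : ℝ)) := by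
        have : (0 : ℝ) ≤ e' := Nat.cast_nonneg _
        linarith
      have h12 := mul_nonneg h11 (sub_nonneg.2 h5)
      nlinarith

end SelfAdjustingHeap

namespace SelfAdjustingHeap
open HTree

/-! ### Potentials of trees -/

namespace HTree

variable {K : Type}

/-- The number of nodes of a tree. -/
def size (t : HTree K) : ℕ := t.entries.length

theorem length_entriesList (ts : List (HTree K)) :
    (entriesList ts).length = (ts.map size).sum := by
  induction ts with
  | nil => rfl
  | cons t ts ih => simp [entriesList, ih, size]

theorem size_eq (t : HTree K) : t.size = 1 + (t.children.map size).sum := by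
  cases t
  simp [size, entries, children, length_entriesList, add_comm]

theorem size_pos (t : HTree K) : 0 < t.size := by
  rw [size_eq]; omega

@[simp] theorem children_addLeft (t c : HTree K) : (t.addLeft c).children = c :: t.children := by
  cases t; rfl

@[simp] theorem children_addRight (t c : HTree K) :
    (t.addRight c).children = t.children ++ [c] := by
  cases t; rfl

@[simp] theorem children_setKey (t : HTree K) (k : WithBot K) :
    (t.setKey k).children = t.children := by
  cases t; rfl

theorem size_addLeft (t c : HTree K) : (t.addLeft c).size = t.size + c.size := by
  simp [size_eq t, size_eq (t.addLeft c)]; omega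

theorem size_addRight (t c : HTree K) : (t.addRight c).size = t.size + c.size := by
  simp [size_eq t, size_eq (t.addRight c)]; omega

@[simp] theorem size_setKey (t : HTree K) (k : WithBot K) : (t.setKey k).size = t.size := by
  simp [size_eq t, size_eq (t.setKey k)]

mutual
/-- The sum of the potentials of the nodes of a tree. -/
noncomputable def treePot (kind : Kind) : HTree K → ℝ
  | node _ _ cs => nodePot kind (cs.map size) + listPot kind cs

/-- The sum of the potentials of the nodes of a list of trees. -/
noncomputable def listPot (kind : Kind) : List (HTree K) → ℝ
  | [] => 0
  | t :: ts => treePot kind t + listPot kind ts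
end

theorem treePot_eq (kind : Kind) (t : HTree K) :
    treePot kind t = nodePot kind (t.children.map size) + listPot kind t.children := by
  cases t
  simp [treePot, children]

theorem listPot_eq (kind : Kind) (ts : List (HTree K)) :
    listPot kind ts = (ts.map (treePot kind)).sum := by
  induction ts with
  | nil => simp [listPot]
  | cons t ts ih => simp [listPot, ih]

/-- The potential of a tree whose root is going to win a link and to get a leftmost child. -/
noncomputable def bufPot (kind : Kind) (t : HTree K) : ℝ :=
  nodePot kind (0 :: t.children.map size) + listPot kind t.children

theorem treePot_le_bufPot (kind : Kind) (t : HTree K) : treePot kind t ≤ bufPot kind t := by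
  rw [treePot_eq, bufPot]
  gcongr
  exact nodePot_mono _ (Dominated.of_sublist (List.sublist_cons_self _ _))

mutual
theorem treePot_nonneg (kind : Kind) : ∀ t : HTree K, 0 ≤ treePot kind t
  | node _ _ cs => by
    rw [treePot]
    exact add_nonneg (nodePot_nonneg _ _) (listPot_nonneg kind cs)

theorem listPot_nonneg (kind : Kind) : ∀ ts : List (HTree K), 0 ≤ listPot kind ts
  | [] => by rw [listPot]
  | t :: ts => by
    rw [listPot]
    exact add_nonneg (treePot_nonneg kind t) (listPot_nonneg kind ts)
end

theorem bufPot_nonneg (kind : Kind) (t : HTree K) : 0 ≤ bufPot kind t :=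
  (treePot_nonneg kind t).trans (treePot_le_bufPot kind t)

theorem treePot_leaf (kind : Kind) (i : ℕ) (k : WithBot K) :
    treePot kind (node i k []) = 0 := by
  simp [treePot, listPot, nodePot_nil]

@[simp] theorem bufPot_setKey (kind : Kind) (t : HTree K) (k : WithBot K) :
    bufPot kind (t.setKey k) = bufPot kind t := by
  simp [bufPot]

@[simp] theorem treePot_setKey (kind : Kind) (t : HTree K) (k : WithBot K) :
    treePot kind (t.setKey k) = treePot kind t := by
  simp [treePot_eq]

/-- The placeholder of weight 0 in `bufPot` may be exchanged for `c`, as the weight of the leftmost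
child is irrelevant. -/
theorem treePot_addLeft_le (kind : Kind) (t c : HTree K) :
    treePot kind (t.addLeft c) ≤ bufPot kind t + treePot kind c := by
  rw [treePot_eq, bufPot]
  simp only [children_addLeft, List.map_cons, listPot]
  have := nodePot_cons_le kind c.size 0 (t.children.map size)
  linarith

/-! ### Cutting -/

/-- Along the path to the cut, weights only decrease or vanish, so no ancestor gains potential. The
cut node trades its leftmost child for the placeholder in `bufPot`. -/
theorem cutList_spec (kind : Kind) (x : ℕ) (cs : List (HTree K)) :
    ∀ t cs', cutList x cs = some (t, cs') →
      listPot kind cs' + bufPot kind t ≤ listPot kind cs ∧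
      Dominated (cs'.map size) (cs.map size) ∧
      (cs'.map size).sum + t.size = (cs.map size).sum := by
  induction cs using cutList.induct x (motive_1 := fun c => ∀ t c', cutBelow x c = some (t, c') →
      treePot kind c' + bufPot kind t ≤ treePot kind c ∧
      bufPot kind c' + bufPot kind t ≤ bufPot kind c ∧ c'.size + t.size = c.size) with
  | case1 i k cs u cs' h ih =>
    rename_i t c' hc
    simp only [cutBelow, h, Option.some.injEq, Prod.mk.injEq] at hc
    obtain ⟨rfl, rfl⟩ := hc
    obtain ⟨h1, h2, h3⟩ := ih _ _ h
    have h4 := nodePot_mono kind h2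
    have h5 := nodePot_mono kind (List.SublistForall₂.cons (le_refl 0) h2)
    refine ⟨?_, ?_, ?_⟩
    · simp only [treePot]; linarith
    · simp only [bufPot, children] at *; linarith
    · rw [size_eq, size_eq (node i k cs)]; simp only [children]; omega
  | case2 i k cs h ih =>
    rename_i t c' hc
    simp [cutBelow, h] at hc
  | case3 => intro t cs' h; simp [cutList] at h
  | case4 ts i k hi =>
    intro t cs' h
    simp only [cutList, hi, if_true, Option.some.injEq, Prod.mk.injEq] at h
    obtain ⟨rfl, rfl⟩ := h
    refine ⟨?_, ?_, ?_⟩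
    · simp [listPot, bufPot, children, nodePot_singleton, treePot_leaf]
    · exact .of_sublist (by simp)
    · simp [add_comm]
  | case5 ts i k y ys hi =>
    intro t cs' h
    simp only [cutList, hi, if_true, Option.some.injEq, Prod.mk.injEq] at h
    obtain ⟨rfl, rfl⟩ := h
    have h1 := nodePot_cons_le kind 0 y.size (ys.map size)
    have h2 := size_eq (node i k (y :: ys))
    have h3 := size_eq (node i k ys)
    simp only [children, List.map_cons, List.sum_cons] at h2 h3
    refine ⟨?_, ?_, ?_⟩
    · simp only [listPot, treePot, bufPot, children, List.map_cons]
      linarith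
    · exact .cons (by omega) (Dominated.rfl' _)
    · simp only [List.map_cons, List.sum_cons]; omega
  | case6 c ts hc u c' h ih =>
    intro t cs' h'
    simp only [cutList, hc, if_false, h, Option.some.injEq, Prod.mk.injEq] at h'
    obtain ⟨rfl, rfl⟩ := h'
    obtain ⟨h1, h2, h3⟩ := ih _ _ h
    refine ⟨?_, ?_, ?_⟩
    · simp only [listPot]; linarith
    · exact .cons (by omega) (Dominated.rfl' _)
    · simp only [List.map_cons, List.sum_cons]; omega
  | case7 c ts hc h u cs'' h' ih ih' =>
    intro t cs' h''
    simp only [cutList, hc, if_false, h, h', Option.some.injEq, Prod.mk.injEq] at h''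
    obtain ⟨rfl, rfl⟩ := h''
    obtain ⟨h1, h2, h3⟩ := ih' _ _ h'
    refine ⟨?_, ?_, ?_⟩
    · simp only [listPot]; linarith
    · exact .cons le_rfl h2
    · simp only [List.map_cons, List.sum_cons]; omega
  | case8 c ts hc h h' ih ih' =>
    intro t cs' h''
    simp [cutList, hc, h, h'] at h''

/-- The same accounting for a cut below a buffer root, whose own placeholder stays in front. -/
theorem cutBelow_spec (kind : Kind) (x : ℕ) (c t c' : HTree K) (h : cutBelow x c = some (t, c')) :
    bufPot kind c' + bufPot kind t ≤ bufPot kind c ∧ c'.size + t.size = c.size := by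
  obtain ⟨i, k, cs⟩ := c
  rw [cutBelow] at h
  split at h
  · next u cs' hu =>
    simp only [Option.some.injEq, Prod.mk.injEq] at h
    obtain ⟨rfl, rfl⟩ := h
    obtain ⟨h1, h2, h3⟩ := cutList_spec kind x cs _ _ hu
    have h5 := nodePot_mono kind (List.SublistForall₂.cons (le_refl 0) h2)
    constructor
    · simp only [bufPot, children] at *; linarith
    · rw [size_eq, size_eq (node i k cs)]; simp only [children]; omega
  · simp at h

/-- Cutting below the roots of a list of trees. -/
theorem cutList_spec_of_notMem (kind : Kind) (x : ℕ) (cs : List (HTree K))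
    (hx : x ∉ cs.map HTree.id) :
    ∀ t cs', cutList x cs = some (t, cs') →
      (cs'.map (bufPot kind)).sum + bufPot kind t ≤ (cs.map (bufPot kind)).sum ∧
      cs'.length = cs.length ∧ (cs'.map size).sum + t.size = (cs.map size).sum := by
  induction cs with
  | nil => intro t cs' h; simp [cutList] at h
  | cons c cs ih =>
    simp only [List.map_cons, List.mem_cons, not_or] at hx
    intro t cs' h
    unfold cutList at h
    rw [if_neg (Ne.symm hx.1)] at h
    split at h
    · next u c' hu =>
      simp only [Option.some.injEq, Prod.mk.injEq] at h
      obtain ⟨rfl, rfl⟩ := h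
      obtain ⟨h1, h2⟩ := cutBelow_spec kind x c _ _ hu
      refine ⟨?_, by simp, ?_⟩
      · simp only [List.map_cons, List.sum_cons]; linarith
      · simp only [List.map_cons, List.sum_cons]; omega
    · split at h
      · next u cs'' hu =>
        simp only [Option.some.injEq, Prod.mk.injEq] at h
        obtain ⟨rfl, rfl⟩ := h
        obtain ⟨h1, h2, h3⟩ := ih hx.2 _ _ hu
        refine ⟨?_, by simp [h2], ?_⟩
        · simp only [List.map_cons, List.sum_cons]; linarith
        · simp only [List.map_cons, List.sum_cons]; omega
      · simp at h

/-! ### Linking -/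

/-- Adding at most one child on each side raises the potential by at most the logarithm of the size
per new child. -/
theorem treePot_addRight?_addLeft?_le (kind : Kind) (l r : Option (HTree K)) (p : HTree K) :
    treePot kind (addRight? kind r (addLeft? l p)) ≤
      treePot kind p + (l.elim 0 (treePot kind) + r.elim 0 (treePot kind)) +
        (l.elim 0 (fun _ => 1) + r.elim 0 (fun _ => 1)) * lg p.size := by
  have hs := size_eq p
  rcases l with _ | l <;> rcases r with _ | r
  · simp [addLeft?, addRight?]
  · have h1 := nodePot_cons_le_add kind r.size (p.children.map size)
    cases kind
    · simp only [addLeft?, addRight?, treePot_eq _ (p.addLeft _), treePot_eq _ p, children_addLeft,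
        List.map_cons, listPot, hs, Option.elim]
      linarith
    · have h2 := nodePot_smooth_concat_le r.size (p.children.map size)
      simp only [addLeft?, addRight?, treePot_eq _ (p.addRight _), treePot_eq _ p,
        children_addRight, List.map_append, List.map_cons, List.map_nil, listPot_eq,
        List.sum_append, List.sum_cons, List.sum_nil, hs, Option.elim]
      linarith
  · have h1 := nodePot_cons_le_add kind l.size (p.children.map size)
    simp only [addLeft?, addRight?, treePot_eq _ (p.addLeft _), treePot_eq _ p, children_addLeft,
      List.map_cons, listPot, hs, Option.elim]
    linarith
  · cases kind
    · have h2 := nodePot_slim_cons_cons_le l.size r.size (p.children.map size)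
      simp only [addLeft?, addRight?, treePot_eq _ ((p.addLeft _).addLeft _), treePot_eq _ p,
        children_addLeft, List.map_cons, listPot, hs, Option.elim]
      linarith
    · have h2 := nodePot_smooth_cons_concat_le l.size r.size (p.children.map size)
      simp only [addLeft?, addRight?, treePot_eq _ ((p.addLeft _).addRight _), treePot_eq _ p,
        children_addRight, children_addLeft, List.map_append, List.map_cons, List.map_nil,
        listPot_eq, List.sum_append, List.sum_cons, List.sum_nil, hs, Option.elim]
      linarith

theorem size_addRight?_addLeft? (kind : Kind) (l r : Option (HTree K)) (p : HTree K) :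
    (addRight? kind r (addLeft? l p)).size = l.elim 0 size + (p.size + r.elim 0 size) := by
  cases kind <;> cases l <;> cases r <;>
    simp [addLeft?, addRight?, size_addLeft, size_addRight] <;> omega

end HTree

variable {K : Type}

theorem BinTree.size_build (kind : Kind) (t : BinTree (HTree K)) :
    (t.build kind).elim 0 size = (t.inorder.map size).sum := by
  induction t with
  | nil => rfl
  | node l p r hl hr =>
    simp only [build, Option.elim_some, size_addRight?_addLeft?, hl, hr, inorder, List.map_append,
      List.map_cons, List.sum_append, List.sum_cons]

theorem BinTree.elim_build (kind : Kind) (t : BinTree (HTree K)) :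
    (t.build kind).elim (0 : ℝ) (fun _ => 1) = t.indicator := by
  cases t <;> simp [build, indicator]

/-- The term 1 in each `lg w + 1` of `linkCost` exceeds the rise in potential. These terms add up to
the number of links, which is therefore free to pay for time. -/
theorem BinTree.treePot_build_le (kind : Kind) (t : BinTree (HTree K)) :
    (t.build kind).elim 0 (treePot kind) + t.degrees.sum ≤
      (t.inorder.map (treePot kind)).sum + linkCost t.degrees (t.inorder.map size) := by
  induction t with
  | nil => simp [build, degrees, inorder, linkCost]
  | node l p r hl hr =>
    have h := treePot_addRight?_addLeft?_le kind (l.build kind) (r.build kind) p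
    rw [elim_build, elim_build] at h
    simp only [build, Option.elim_some, inorder, List.map_append, List.map_cons, degrees,
      List.sum_append, List.sum_cons]
    rw [linkCost_append (by simp [length_degrees]), linkCost]
    simp only [Nat.cast_add]
    linarith

variable [LinearOrder K]

theorem size_linkFrom (kind : Kind) (v : HTree K) (R : List (HTree K)) :
    (linkFrom kind [] v R).val.size = ((v :: R).map size).sum := by
  obtain ⟨t, ht, hR⟩ := exists_build_eq_linkFrom_nil kind v R
  simpa [ht, hR] using t.size_build kind

/-- Linking the children of a node together with other roots. -/
theorem treePot_linkFrom_le (kind : Kind) (m : HTree K) (rs : List (HTree K)) (v : HTree K)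
    (R : List (HTree K)) (h : m.children ++ rs = v :: R) :
    treePot kind (linkFrom kind [] v R).val + R.length ≤
      treePot kind m + 7 * lg m.size +
        (rs.map fun t => treePot kind t + 2 * (lg t.size + 1)).sum := by
  obtain ⟨t, ht, hR⟩ := exists_build_eq_linkFrom_nil kind v R
  rw [← h] at hR
  have hpot := t.treePot_build_le kind
  rw [ht, hR, List.map_append, List.map_append] at hpot
  obtain ⟨A, B, hAB, hpotAB⟩ := exists_suffixPot_add_le_nodePot kind (m.children.map size)
  have hm := size_eq m
  have hlen : t.degrees.length = A.length + (B.length + rs.length) := by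
    rw [t.length_degrees, hR]
    have := congrArg List.length hAB
    simp only [List.length_map, List.length_append] at this ⊢
    omega
  obtain ⟨DA, DB, DC, hD, hA, hB, hC⟩ : ∃ DA DB DC : List ℕ, t.degrees = DA ++ (DB ++ DC) ∧
      DA.length = A.length ∧ DB.length = B.length ∧ DC.length = rs.length := by
    refine ⟨t.degrees.take A.length, (t.degrees.drop A.length).take B.length,
      (t.degrees.drop A.length).drop B.length, by simp, ?_, ?_, ?_⟩ <;> simp <;> omega
  have htwo : ∀ d ∈ DA ++ (DB ++ DC), d ≤ 2 := hD ▸ t.degrees_le_two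
  have htotal : (DA ++ (DB ++ DC)).sum + 1 = (DA ++ (DB ++ DC)).length := by
    rw [← hD, ← t.sum_degrees]
    have : t.indicator = 1 := by
      cases t
      · simp [BinTree.build] at ht
      · rfl
    omega
  have hpos : ∀ w ∈ A ++ B, 0 < w := by
    rw [← hAB]
    intro w hw
    obtain ⟨c, -, rfl⟩ := List.mem_map.1 hw
    exact c.size_pos
  have hcostA := linkCost_le_suffixPot (ds := DA) (ws := A) 0
    (fun w hw => hpos w (by simp [hw])) (fun d hd => htwo d (by simp [hd])) hA
    (fun u v huv => t.sum_degrees_prefix u (v ++ (DB ++ DC)) (by simp [hD, huv]))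
  -- Here the excess is 1: a final stretch of `DB` followed by `DC` sums to at most its length,
  -- while `DC` alone may fall short of its length by one.
  have hcostB := linkCost_le_suffixPot (ds := DB.reverse) (ws := B.reverse) 1
    (fun w hw => hpos w (by simp_all)) (fun d hd => htwo d (by simp_all)) (by simpa using hB)
    (fun u v huv => by
      have huv' : DB = v.reverse ++ u.reverse := by
        rw [← List.reverse_append, ← huv, List.reverse_reverse]
      have h1 := t.sum_degrees_suffix (DA ++ v.reverse) (u.reverse ++ DC) (by simp [hD, huv'])
      have h2 := t.sum_degrees_prefix (DA ++ DB) DC (by simp [hD])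
      simp only [List.sum_append, List.length_append, List.sum_reverse, List.length_reverse]
        at h1 h2 htotal
      omega)
  have hcostC := linkCost_le_of_le_two (ds := DC) (ws := rs.map size)
    (fun d hd => htwo d (by simp [hd])) (by simpa using hC)
  rw [linkCost_reverse hB] at hcostB
  have hlenR : (DA ++ (DB ++ DC)).length = R.length + 1 := by
    rw [← hD, t.length_degrees, hR, h]; rfl
  have hsum : ((DA ++ (DB ++ DC)).sum : ℝ) = R.length := by
    have : (DA ++ (DB ++ DC)).sum = R.length := by omega
    rw [this]
  have hcost : linkCost t.degrees (m.children.map size ++ rs.map size) =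
      linkCost DA A + (linkCost DB B + linkCost DC (rs.map size)) := by
    rw [hD, hAB, List.append_assoc, linkCost_append hA, linkCost_append hB]
  have hAB' := congrArg List.sum hAB
  rw [List.sum_append] at hAB'
  -- The factor 7 is 2 from the left part, 3 from the right part with its excess, and 2 for the
  -- exempt children.
  have h1 := lg_mono (show 1 + A.sum ≤ m.size by omega)
  have h2 := lg_mono (show 1 + B.reverse.sum ≤ m.size by rw [List.sum_reverse]; omega)
  have h3 := treePot_eq kind m
  rw [listPot_eq] at h3
  rw [hcost, hD, Option.elim_some, hsum, List.sum_append] at hpot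
  rw [← hm] at hpotAB
  rw [List.map_map] at hcostC
  have h4 : (rs.map fun t => treePot kind t + 2 * (lg t.size + 1)).sum =
      (rs.map (treePot kind)).sum + (rs.map ((fun w => 2 * (lg w + 1)) ∘ size)).sum :=
    List.sum_map_add
  rw [h4]
  push_cast at hcostA hcostB
  linarith

end SelfAdjustingHeap

namespace SelfAdjustingHeap
open HTree

variable {K : Type} [LinearOrder K]

/-! ### Sorting -/

theorem merge_perm (xs ys : List (HTree K)) : (merge xs ys).val.Perm (xs ++ ys) := by
  induction xs, ys using merge.induct with
  | case1 ys => simp [merge]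
  | case2 x xs => simp [merge]
  | case3 x xs y ys ih ih' =>
    by_cases h : y.key ≤ x.key
    · simpa [merge, h] using ih
    · simp only [merge, h, if_false, Timed.val_bind, Timed.val_pure]
      exact (List.Perm.cons y ih').trans (List.perm_middle (l₁ := x :: xs)).symm

theorem time_merge_le (xs ys : List (HTree K)) :
    (merge xs ys).time ≤ xs.length + ys.length := by
  induction xs, ys using merge.induct with
  | case1 ys => simp [merge]
  | case2 x xs => simp [merge]
  | case3 x xs y ys ih ih' =>
    simp only [merge, Timed.time_bind, time_spend, List.length_cons] at ih ih' ⊢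
    split_ifs <;> simp only [Timed.time_bind, Timed.time_pure] <;> omega

theorem merge_pairwise (xs ys : List (HTree K)) (hx : xs.Pairwise fun a b => b.key ≤ a.key)
    (hy : ys.Pairwise fun a b => b.key ≤ a.key) :
    (merge xs ys).val.Pairwise fun a b => b.key ≤ a.key := by
  induction xs, ys using merge.induct with
  | case1 ys => simpa [merge] using hy
  | case2 x xs => simpa [merge] using hx
  | case3 x xs y ys ih ih' =>
    by_cases h : y.key ≤ x.key
    · simp only [merge, h, if_true, Timed.val_bind, Timed.val_pure]
      refine List.Pairwise.cons (fun z hz => ?_) (ih hx.of_cons hy)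
      rcases List.mem_append.1 ((merge_perm _ _).mem_iff.1 hz) with hz | hz
      · exact List.rel_of_pairwise_cons hx hz
      · rcases List.mem_cons.1 hz with rfl | hz
        · exact h
        · exact (List.rel_of_pairwise_cons hy hz).trans h
    · simp only [merge, h, if_false, Timed.val_bind, Timed.val_pure]
      refine List.Pairwise.cons (fun z hz => ?_) (ih' hx hy.of_cons)
      rcases List.mem_append.1 ((merge_perm _ _).mem_iff.1 hz) with hz | hz
      · rcases List.mem_cons.1 hz with rfl | hz
        · exact (not_le.1 h).le
        · exact (List.rel_of_pairwise_cons hx hz).trans (not_le.1 h).le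
      · exact List.rel_of_pairwise_cons hy hz

theorem mergeSort_perm (l : List (HTree K)) : (mergeSort l).val.Perm l := by
  induction l using mergeSort.induct with
  | case1 => simp [mergeSort]
  | case2 a => simp [mergeSort]
  | case3 a b l h1 h2 =>
    simp only [mergeSort, Timed.val_bind]
    refine (merge_perm _ _).trans ((h1.append h2).trans ?_)
    rw [List.take_append_drop]

theorem mergeSort_pairwise (l : List (HTree K)) :
    (mergeSort l).val.Pairwise fun a b => b.key ≤ a.key := by
  induction l using mergeSort.induct with
  | case1 => simp [mergeSort]
  | case2 a => simp [mergeSort]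
  | case3 a b l h1 h2 =>
    simp only [mergeSort, Timed.val_bind]
    exact merge_pairwise _ _ h1 h2

theorem time_mergeSort_le (l : List (HTree K)) :
    (mergeSort l).time ≤ 2 * l.length * Nat.clog 2 l.length := by
  induction l using mergeSort.induct with
  | case1 => simp [mergeSort]
  | case2 a => simp [mergeSort]
  | case3 a b l h1 h2 =>
    have hm := time_merge_le (mergeSort ((a :: b :: l).take ((l.length + 2) / 2))).val
      (mergeSort ((a :: b :: l).drop ((l.length + 2) / 2))).val
    rw [(mergeSort_perm _).length_eq, (mergeSort_perm _).length_eq] at hm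
    simp only [mergeSort, Timed.time_bind, time_spend]
    have hn : (a :: b :: l).length = l.length + 2 := rfl
    rw [hn]
    simp only [List.length_take, List.length_drop, hn] at h1 h2 hm
    set n := l.length + 2 with hn'
    -- The larger half has ⌈n/2⌉ elements, so one level of recursion uses up exactly one unit of
    -- `Nat.clog`; the level itself costs at most n for splitting and n for merging.
    have hc : Nat.clog 2 n = Nat.clog 2 (n - n / 2) + 1 := by
      rw [Nat.clog_of_two_le one_lt_two (by omega)]
      congr 2; omega
    have hmin : min (n / 2) n = n / 2 := by omega
    rw [hmin] at h1 hm
    have h3 : Nat.clog 2 (n / 2) ≤ Nat.clog 2 (n - n / 2) := Nat.clog_mono_right _ (by omega)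
    rw [hc]
    generalize Nat.clog 2 (n - n / 2) = c at *
    have h4 : 2 * (n / 2) * Nat.clog 2 (n / 2) ≤ 2 * (n / 2) * c := Nat.mul_le_mul_left _ h3
    have h5 : 2 * n * (c + 1) = 2 * (n / 2) * c + 2 * (n - n / 2) * c + 2 * n := by
      have : 2 * n = 2 * (n / 2) + 2 * (n - n / 2) := by omega
      rw [mul_add, ← add_mul, ← this, mul_one]
    omega

theorem clog_le_lg_add_one {n : ℕ} (hn : 0 < n) : (Nat.clog 2 n : ℝ) ≤ lg n + 1 := by
  rcases Nat.lt_or_ge 1 n with h | h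
  · have h1 := Nat.pow_pred_clog_lt_self one_lt_two h
    have h2 := lg_mono h1.le
    have h3 : lg (2 ^ (Nat.clog 2 n).pred) = (Nat.clog 2 n).pred := by
      simp [lg, Real.logb_pow]
    have h4 : Nat.clog 2 n ≤ (Nat.clog 2 n).pred + 1 := by simp; omega
    have h5 : (Nat.clog 2 n : ℝ) ≤ ((Nat.clog 2 n).pred : ℝ) + 1 := by exact_mod_cast h4
    linarith
  · obtain rfl : n = 1 := by omega
    simp [lg_one]

/-- Linking a sorted list of roots results in a path of the roots. -/
theorem treePot_linkFrom_le_of_pairwise (kind : Kind) (v : HTree K) (R : List (HTree K))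
    (h : (v :: R).Pairwise fun a b => b.key ≤ a.key) :
    treePot kind (linkFrom kind [] v R).val ≤ treePot kind v + (R.map (bufPot kind)).sum := by
  induction R generalizing v with
  | nil => simp [linkFrom]
  | cons w R ih =>
    have hvw : w.key ≤ v.key := List.rel_of_pairwise_cons h (by simp)
    -- In non-increasing order the next root always wins, ties included, so the current root never
    -- acquires a left neighbour.
    simp only [linkFrom, Timed.val_bind, not_lt.2 hvw, if_false, val_link_of_le kind hvw, addLeft?]
    have hkey : (w.addLeft v).key = w.key := by cases w; rfl
    have hw := List.pairwise_cons.1 h.of_cons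
    refine (ih (w.addLeft v) (List.pairwise_cons.2 ⟨?_, hw.2⟩)).trans ?_
    · rw [hkey]; exact hw.1
    · have := treePot_addLeft_le kind w v
      simp only [List.map_cons, List.sum_cons]
      linarith

/-! ### Lists of roots -/

theorem insertRoot_perm (t : HTree K) (l : List (HTree K)) : (insertRoot t l).val.Perm (t :: l) := by
  cases l with
  | nil => simp [insertRoot]
  | cons m l =>
    simp only [insertRoot, Timed.val_bind]
    split_ifs
    · simp
    · simpa using List.Perm.swap t m l

theorem time_insertRoot_le (t : HTree K) (l : List (HTree K)) : (insertRoot t l).time ≤ 2 := by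
  cases l with
  | nil => simp [insertRoot]
  | cons m l =>
    simp only [insertRoot, Timed.time_bind, time_spend]
    split_ifs <;> simp

theorem catRoots_perm (l l' : List (HTree K)) : (catRoots l l').val.Perm (l ++ l') := by
  rcases l with _ | ⟨m, l⟩ <;> rcases l' with _ | ⟨m', l'⟩
  · simp [catRoots]
  · simp [catRoots]
  · simp [catRoots]
  · simp only [catRoots, Timed.val_bind]
    split_ifs
    · exact List.perm_append_comm (l₁ := m' :: l')
    · simp

theorem time_catRoots_le (l l' : List (HTree K)) : (catRoots l l').time ≤ 2 := by
  rcases l with _ | ⟨m, l⟩ <;> rcases l' with _ | ⟨m', l'⟩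
  · simp [catRoots]
  · simp [catRoots]
  · simp [catRoots]
  · simp only [catRoots, Timed.time_bind, time_spend]
    split_ifs <;> simp

theorem time_lowerRoot (x : ℕ) (k : WithBot K) (l : List (HTree K)) :
    (lowerRoot x k l).time = 2 := by
  simp only [lowerRoot, Timed.time_bind, time_spend]
  split
  · simp
  · split_ifs <;> simp

theorem lowerRoot_perm (x : ℕ) (k : WithBot K) (l : List (HTree K)) :
    (lowerRoot x k l).val.Perm (l.map fun t => if t.id = x then t.setKey k else t) := by
  simp only [lowerRoot, Timed.val_bind]
  split
  · next h => simp [h]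
  · split_ifs
    · exact List.rotate_perm _ _
    · simp

theorem sum_map_lowerRoot {M : Type} [AddCommMonoid M] (f : HTree K → M)
    (hf : ∀ t k, f (t.setKey k) = f t) (x : ℕ) (k : WithBot K) (l : List (HTree K)) :
    ((lowerRoot x k l).val.map f).sum = (l.map f).sum := by
  rw [((lowerRoot_perm x k l).map f).sum_eq, List.map_map]
  congr 1
  refine List.map_congr_left fun t _ => ?_
  simp only [Function.comp_apply]
  split_ifs
  · exact hf t k
  · rfl

theorem length_lowerRoot (x : ℕ) (k : WithBot K) (l : List (HTree K)) :
    (lowerRoot x k l).val.length = l.length := by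
  simpa using (lowerRoot_perm x k l).length_eq

end SelfAdjustingHeap

namespace SelfAdjustingHeap
open HTree

/-! ### Logarithmic bounds -/

theorem one_le_lgBound (n : ℕ) : 1 ≤ lgBound n := by
  unfold lgBound
  split_ifs with h
  · exact le_rfl
  · rw [← Real.logb_self_eq_one one_lt_two]
    exact Real.logb_le_logb_of_le one_lt_two two_pos (by exact_mod_cast (by omega : 2 ≤ n))

/-- The factor 2 is only for n < 4, where lg n < 2 but the bound is 1. -/
theorem lg_le_lgBound (n : ℕ) : lg n ≤ 2 * lgBound n := by
  have h1 := one_le_lgBound n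
  rcases Nat.lt_or_ge n 4 with h | h
  · have h2 := lg_mono h.le
    have h3 : lg 4 = 2 := by
      rw [show 4 = 2 * 2 from rfl, lg_two_mul two_pos, lg_two]; norm_num
    linarith
  · have : lgBound n = lg n := by rw [lgBound, if_neg (by omega), lg]
    linarith

theorem two_le_logb {n : ℕ} (h : ¬ n < 4) : 2 ≤ Real.logb 2 n := by
  rw [Real.le_logb_iff_rpow_le one_lt_two (by exact_mod_cast (by omega : 0 < n))]
  norm_num
  exact_mod_cast (by omega : 4 ≤ n)

theorem one_le_lglgBound (n : ℕ) : 1 ≤ lglgBound n := by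
  unfold lglgBound
  split_ifs with h
  · exact le_rfl
  · rw [← Real.logb_self_eq_one one_lt_two]
    exact Real.logb_le_logb_of_le one_lt_two two_pos (two_le_logb h)

theorem lglgBound_le_lgBound (n : ℕ) : lglgBound n ≤ lgBound n := by
  unfold lglgBound lgBound
  split_ifs with h
  · exact le_rfl
  · have h2 := two_le_logb h
    rw [Real.logb_le_iff_le_rpow one_lt_two (by linarith),
      Real.rpow_logb two_pos (by norm_num) (by exact_mod_cast (by omega : 0 < n))]
    have hn : (0 : ℝ) < n := by exact_mod_cast (by omega : 0 < n)
    rw [Real.logb_le_iff_le_rpow one_lt_two hn, Real.rpow_natCast]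
    exact_mod_cast Nat.lt_two_pow_self.le

/-- The hypothesis says that b is zero or less than lg n; passing from b to b + 1 at most doubles a
positive b. -/
theorem lg_succ_le_lglgBound {b n : ℕ} (h : b = 0 ∨ 2 ^ b < n) : lg (b + 1) ≤ 1 + lglgBound n := by
  have h1 := one_le_lglgBound n
  rcases Nat.eq_zero_or_pos b with rfl | hb
  · rw [zero_add, lg_one]; linarith
  have h2 : 2 ^ b < n := h.resolve_left hb.ne'
  have h3 : lg (b + 1) ≤ lg b + 1 := by
    rw [← lg_two_mul hb]; exact lg_mono (by omega)
  by_cases hn : n < 4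
  · have : b < 2 := by
      by_contra! hb2
      have := Nat.pow_le_pow_right two_pos hb2
      omega
    obtain rfl : b = 1 := by omega
    rw [lg_one] at h3
    linarith
  · have h4 : (b : ℝ) ≤ Real.logb 2 n := by
      rw [Real.le_logb_iff_rpow_le one_lt_two (by exact_mod_cast (by omega : 0 < n)),
        Real.rpow_natCast]
      exact_mod_cast h2.le
    have h5 : lg b ≤ lglgBound n := by
      rw [lg, lglgBound, if_neg hn]
      exact Real.logb_le_logb_of_le one_lt_two (by exact_mod_cast hb) h4
    linarith

/-- lg(b + 1) - lg b is at most 1 / (b ln 2), hence at most 2 / b. -/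
theorem succ_mul_lg_succ_le (b : ℕ) :
    ((b + 1 : ℕ) : ℝ) * lg (b + 1) ≤ b * lg b + lg (b + 1) + 2 := by
  rcases Nat.eq_zero_or_pos b with rfl | hb
  · simp [lg_one]
  have hb' : (0 : ℝ) < b := by exact_mod_cast hb
  have h1 : lg (b + 1) - lg b ≤ 2 / b := by
    have hl : (1 : ℝ) / 2 < Real.log 2 := by have := Real.log_two_gt_d9; linarith
    rw [lg, lg, ← Real.logb_div (by positivity) (by positivity), Real.logb,
      div_le_iff₀ (by linarith)]
    have h2 := Real.log_le_sub_one_of_pos (show (0 : ℝ) < ((b + 1 : ℕ) : ℝ) / b by positivity)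
    have h3 : ((b + 1 : ℕ) : ℝ) / b - 1 = 1 / b := by push_cast; field_simp; ring
    rw [h3] at h2
    refine h2.trans ?_
    rw [div_mul_eq_mul_div]
    gcongr
    linarith
  have h4 : (b : ℝ) * (lg (b + 1) - lg b) ≤ 2 := by
    calc (b : ℝ) * (lg (b + 1) - lg b) ≤ b * (2 / b) := by gcongr
      _ = 2 := by field_simp
  push_cast
  linarith

/-! ### The potential of a heap -/

section Pot

variable {K : Type}

/-- The potential of a tree in a list of roots. -/
noncomputable def rootPot (kind : Kind) (t : HTree K) : ℝ := treePot kind t + 2 * (lg t.size + 1)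

/-- The potential of a number of roots in a buffer that pays for sorting them. -/
noncomputable def bufCredit (b : ℕ) : ℝ := 2 * (b * lg b) + 45 * b

theorem rootPot_nonneg (kind : Kind) (t : HTree K) : 0 ≤ rootPot kind t := by
  have := treePot_nonneg kind t
  have := lg_nonneg t.size
  unfold rootPot
  linarith

theorem bufCredit_nonneg (b : ℕ) : 0 ≤ bufCredit b := by
  have := lg_nonneg b
  unfold bufCredit
  positivity

/-- The source of the lg lg n in decrease-key: one more buffer root raises the sorting credit by O(1
+ lg b), with b below lg n. -/
theorem bufCredit_succ_le (b : ℕ) : bufCredit (b + 1) ≤ bufCredit b + 2 * lg (b + 1) + 49 := by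
  have := succ_mul_lg_succ_le b
  unfold bufCredit
  push_cast at this ⊢
  linarith

theorem sum_map_rootPot (kind : Kind) (ts : List (HTree K)) :
    (ts.map (rootPot kind)).sum =
      listPot kind ts + ((ts.map size).map fun w => 2 * (lg w + 1)).sum := by
  rw [listPot_eq, List.map_map]
  exact List.sum_map_add

theorem sum_map_lg_le_of_dominated {l l' : List ℕ} (h : Dominated l l') :
    (l.map fun w => 2 * (lg w + 1)).sum ≤ (l'.map fun w => 2 * (lg w + 1)).sum := by
  have hnn (w : ℕ) : 0 ≤ 2 * (lg w + 1) := by have := lg_nonneg w; linarith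
  induction h with
  | nil =>
    refine List.sum_nonneg fun x hx => ?_
    obtain ⟨w, -, rfl⟩ := List.mem_map.1 hx
    exact hnn w
  | cons hab _ ih =>
    have := lg_mono hab
    simp only [List.map_cons, List.sum_cons]
    linarith
  | @cons_right b _ _ _ ih =>
    have := hnn b
    simp only [List.map_cons, List.sum_cons]
    linarith

namespace Heap

theorem size_eq (H : Heap K) :
    H.size = (H.roots.map HTree.size).sum + (H.buffer.map HTree.size).sum := by
  simp [size, entries, length_entriesList]

/-- The potential of a heap. -/
noncomputable def pot (kind : Kind) (H : Heap K) : ℝ :=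
  8 * (H.roots.map (rootPot kind)).sum + 8 * (H.buffer.map (bufPot kind)).sum +
    bufCredit H.buffer.length + 16 * lg (1 + H.size)

theorem pot_nonneg (kind : Kind) (H : Heap K) : 0 ≤ H.pot kind := by
  have h1 : 0 ≤ (H.roots.map (rootPot kind)).sum := List.sum_nonneg fun x hx => by
    obtain ⟨w, -, rfl⟩ := List.mem_map.1 hx
    exact rootPot_nonneg kind w
  have h2 : 0 ≤ (H.buffer.map (bufPot kind)).sum := List.sum_nonneg fun x hx => by
    obtain ⟨w, -, rfl⟩ := List.mem_map.1 hx
    exact bufPot_nonneg kind w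
  have h3 := bufCredit_nonneg H.buffer.length
  have h4 := lg_nonneg (1 + H.size)
  unfold pot
  linarith

/-- The buffer, if it is not empty, contains less than `lg n` roots. -/
def Balanced (H : Heap K) : Prop := H.buffer = [] ∨ 2 ^ H.buffer.length < H.size

theorem Balanced.of_le {H H' : Heap K} (h : H.Balanced) (hb : H'.buffer.length = H.buffer.length)
    (hs : H.size ≤ H'.size) : H'.Balanced := by
  rcases h with h | h
  · left
    simpa [h] using hb
  · right
    rw [hb]
    omega

theorem cut_spec (kind : Kind) {x : ℕ} {H H₁ : Heap K} {t : HTree K}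
    (hx : x ∉ H.buffer.map HTree.id) (h : H.cut x = some (t, H₁)) :
    8 * (H₁.roots.map (rootPot kind)).sum + 8 * (H₁.buffer.map (bufPot kind)).sum +
        8 * bufPot kind t ≤
      8 * (H.roots.map (rootPot kind)).sum + 8 * (H.buffer.map (bufPot kind)).sum ∧
    H₁.buffer.length = H.buffer.length ∧ H₁.size + t.size = H.size := by
  unfold cut at h
  split at h
  · next u rs hu =>
    simp only [Option.some.injEq, Prod.mk.injEq] at h
    obtain ⟨rfl, rfl⟩ := h
    obtain ⟨h1, h2, h3⟩ := cutList_spec kind x _ _ _ hu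
    have h4 := sum_map_lg_le_of_dominated h2
    refine ⟨?_, rfl, ?_⟩
    · simp only [sum_map_rootPot]
      linarith
    · simp only [size_eq]
      omega
  · split at h
    · next u bs hu =>
      simp only [Option.some.injEq, Prod.mk.injEq] at h
      obtain ⟨rfl, rfl⟩ := h
      obtain ⟨h1, h2, h3⟩ := cutList_spec_of_notMem kind x _ hx _ _ hu
      refine ⟨?_, h2, ?_⟩
      · simp only
        linarith
      · simp only [size_eq]
        omega
    · simp at h

end Heap
end Pot

-- Amortized cost of each heap operation

namespace Heap

variable {K : Type} [LinearOrder K]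

theorem time_findMin_le (H : Heap K) : H.findMin.time ≤ 2 := by
  obtain ⟨_ | ⟨m, l⟩, _ | ⟨b, l'⟩⟩ := H
  · simp [findMin]
  · simp [findMin]
  · simp [findMin]
  · simp only [findMin, Timed.time_bind, time_spend]
    split_ifs <;> simp

theorem time_insert_le (x : ℕ) (k : K) (H : Heap K) : (H.insert x k).time ≤ 3 := by
  have := time_insertRoot_le (.node x (k : WithBot K) []) H.roots
  simp only [Heap.insert, Timed.time_bind, time_spend, Timed.time_pure]
  omega

theorem size_insert (x : ℕ) (k : K) (H : Heap K) : (H.insert x k).val.size = H.size + 1 := by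
  have h := ((insertRoot_perm (.node x (k : WithBot K) []) H.roots).map HTree.size).sum_eq
  simp only [size_eq, Heap.insert, Timed.val_bind, Timed.val_pure, h, List.map_cons, List.sum_cons]
  simp [HTree.size_eq (.node x (k : WithBot K) []), children]
  omega

theorem pot_insert_le (kind : Kind) (x : ℕ) (k : K) (H : Heap K) :
    (H.insert x k).val.pot kind ≤ H.pot kind + 32 := by
  have h := ((insertRoot_perm (.node x (k : WithBot K) []) H.roots).map (rootPot kind)).sum_eq
  have h1 : rootPot kind (.node x (k : WithBot K) []) = 2 := by
    simp [rootPot, treePot_leaf, HTree.size_eq, children, lg_one]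
  have h2 : lg (1 + (H.insert x k).val.size) ≤ lg (1 + H.size) + 1 := by
    rw [size_insert, ← lg_two_mul (by omega)]
    exact lg_mono (by omega)
  unfold pot
  simp only [Heap.insert, Timed.val_bind, Timed.val_pure, h, List.map_cons, List.sum_cons, h1] at h2 ⊢
  linarith

theorem buffer_emptyBuffer (kind : Kind) (H : Heap K) : (H.emptyBuffer kind).val.buffer = [] := by
  obtain ⟨rs, _ | ⟨b, bs⟩⟩ := H
  · simp [emptyBuffer]
  · simp only [emptyBuffer, Timed.val_bind]
    split <;> simp

/-- Emptying the buffer. -/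
theorem emptyBuffer_spec (kind : Kind) (H : Heap K) :
    (H.emptyBuffer kind).val.size = H.size ∧
    ((H.emptyBuffer kind).time : ℝ) + 8 * ((H.emptyBuffer kind).val.roots.map (rootPot kind)).sum +
        16 * H.buffer.length ≤
      8 * (H.roots.map (rootPot kind)).sum + 8 * (H.buffer.map (bufPot kind)).sum +
        bufCredit H.buffer.length + 16 * lg H.size := by
  obtain ⟨rs, _ | ⟨b, bs⟩⟩ := H
  · have := lg_nonneg (Heap.size (⟨rs, []⟩ : Heap K))
    simp [emptyBuffer, bufCredit, this]
  have hperm : (mergeSort (bs ++ [b])).val.Perm (b :: bs) :=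
    (mergeSort_perm _).trans (List.perm_append_singleton b bs)
  have hsort := mergeSort_pairwise (bs ++ [b])
  have htime := time_mergeSort_le (bs ++ [b])
  simp only [emptyBuffer, Timed.val_bind, Timed.time_bind, time_spend]
  rcases hs : (mergeSort (bs ++ [b])).val with _ | ⟨v, R⟩
  · rw [hs] at hperm
    simpa using hperm.length_eq
  rw [hs] at hperm hsort
  have hlen := hperm.length_eq
  have hsize := (hperm.map HTree.size).sum_eq
  have hpot := (hperm.map (bufPot kind)).sum_eq
  have h1 := treePot_linkFrom_le_of_pairwise kind v R hsort
  have h2 := time_linkFrom_le kind [] v R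
  have h3 := size_linkFrom kind v R
  simp only [Timed.val_bind, Timed.time_bind, Timed.val_pure, Timed.time_pure]
  set t := (linkFrom kind [] v R).val
  have h4 := insertRoot_perm t rs
  have h5 := (h4.map HTree.size).sum_eq
  have h6 := (h4.map (rootPot kind)).sum_eq
  have h7 := time_insertRoot_le t rs
  have h8 := treePot_le_bufPot kind v
  have hn : Heap.size (⟨rs, b :: bs⟩ : Heap K) = (rs.map HTree.size).sum + t.size := by
    rw [h3, hsize, size_eq]
  have h9 : lg t.size ≤ lg (Heap.size (⟨rs, b :: bs⟩ : Heap K)) := lg_mono (by omega)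
  refine ⟨?_, ?_⟩
  · rw [size_eq, hn]
    simp only [h5, List.map_cons, List.sum_cons, List.map_nil, List.sum_nil]
    omega
  · have h10 := clog_le_lg_add_one (n := bs.length + 1) (by omega)
    have h11 : (mergeSort (bs ++ [b])).time + ((linkFrom kind [] v R).time +
        (insertRoot t rs).time) ≤
        2 * ((bs.length + 1) * Nat.clog 2 (bs.length + 1)) + 8 * bs.length + 2 := by
      simp only [List.length_append, List.length_cons, List.length_nil, zero_add, mul_assoc] at *
      omega
    have h12 : (((bs.length + 1 : ℕ)) : ℝ) * Nat.clog 2 (bs.length + 1) ≤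
        ((bs.length + 1 : ℕ) : ℝ) * (lg (bs.length + 1) + 1) := by gcongr
    have h13 : ((mergeSort (bs ++ [b])).time : ℝ) + ((linkFrom kind [] v R).time +
        (insertRoot t rs).time) ≤
        2 * (((bs.length + 1 : ℕ) : ℝ) * Nat.clog 2 (bs.length + 1)) + 8 * bs.length + 2 := by
      exact_mod_cast h11
    simp only [h6, List.map_cons, List.sum_cons, List.length_cons] at hpot ⊢
    -- Against the credit 45 b stand 2 b from rounding the logarithm up, at most 8 b for the links,
    -- the 16 b kept aside, and constants absorbed because b ≥ 1.
    simp only [rootPot, bufCredit]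
    push_cast at *
    linarith

/-- The cost 16 lg n prepays the final root in the root list. The surplus of 16 per buffer root
cancels it when the buffer holds at least lg n roots. -/
theorem pot_emptyBuffer_le (kind : Kind) (H : Heap K) :
    ((H.emptyBuffer kind).time : ℝ) + (H.emptyBuffer kind).val.pot kind + 16 * H.buffer.length ≤
      H.pot kind + 16 * lg H.size := by
  obtain ⟨h1, h2⟩ := emptyBuffer_spec kind H
  simp only [pot, buffer_emptyBuffer, h1]
  simp [bufCredit] at h2 ⊢
  linarith

theorem buffer_deleteMin (kind : Kind) (H : Heap K) : (H.deleteMin kind).val.buffer = [] := by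
  simp only [deleteMin, Timed.val_bind]
  split <;> simp [buffer_emptyBuffer]

/-- 88 = 16 + 8 · 7 + 16: emptying the buffer, linking the exposed children, and prepaying the
single new root. The factor 8 in `Heap.pot` matches the at most 8 steps per link. -/
theorem pot_deleteMin_le (kind : Kind) (H : Heap K) :
    ((H.deleteMin kind).time : ℝ) + (H.deleteMin kind).val.pot kind ≤
      H.pot kind + 88 * lg H.size + 18 := by
  have hE := pot_emptyBuffer_le kind H
  have hs := (emptyBuffer_spec kind H).1
  have hb := buffer_emptyBuffer kind H
  have hlg := lg_nonneg H.size
  simp only [deleteMin, Timed.val_bind, Timed.time_bind, time_spend]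
  generalize (H.emptyBuffer kind).time = T at *
  generalize (H.emptyBuffer kind).val = G at *
  obtain ⟨_ | ⟨m, rs⟩, _⟩ := G
  · simp only [Timed.val_pure, Timed.time_pure] at *
    push_cast
    linarith
  obtain rfl : _ = [] := hb
  simp only [Timed.val_bind, Timed.time_bind, Timed.val_pure, Timed.time_pure, time_spend]
  rw [size_eq] at hs
  simp only [List.map_cons, List.sum_cons, List.map_nil, List.sum_nil, add_zero] at hs
  have hm := HTree.size_eq m
  have hmn := lg_mono (show m.size ≤ H.size by omega)
  have hrs : 0 ≤ (rs.map (rootPot kind)).sum := List.sum_nonneg fun x hx => by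
    obtain ⟨w, -, rfl⟩ := List.mem_map.1 hx
    exact rootPot_nonneg kind w
  rcases hR : m.children ++ rs with _ | ⟨v, R⟩
  · have h1 := rootPot_nonneg kind m
    simp only [linkAll, Timed.val_pure, Timed.time_pure]
    have h2 := lg_mono (show
      1 + Heap.size (⟨[], []⟩ : Heap K) ≤ 1 + Heap.size (⟨m :: rs, []⟩ : Heap K) by
      simp [size_eq])
    simp only [pot, List.map_cons, List.sum_cons] at *
    simp only [List.map_nil, List.sum_nil] at *
    push_cast
    linarith
  · have h1 := treePot_linkFrom_le kind m rs v R hR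
    have h2 := time_linkFrom_le kind [] v R
    have h3 := size_linkFrom kind v R
    rw [← hR, List.map_append, List.sum_append] at h3
    simp only [linkAll, Timed.val_bind, Timed.time_bind, Timed.val_pure, Timed.time_pure]
    generalize (linkFrom kind [] v R).val = t at *
    have h2' : ((linkFrom kind [] v R).time : ℝ) ≤ 8 * R.length := by
      have : (linkFrom kind [] v R).time ≤ 8 * R.length := by
        simp only [List.length_nil] at h2; omega
      exact_mod_cast this
    have h4 := lg_mono (show
      1 + Heap.size (⟨[t], []⟩ : Heap K) ≤ 1 + Heap.size (⟨m :: rs, []⟩ : Heap K) by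
      simp only [size_eq, List.map_cons, List.sum_cons, List.map_nil, List.sum_nil]; omega)
    have h5 := lg_mono (show t.size ≤ H.size by omega)
    have h6 : (rs.map fun t => treePot kind t + 2 * (lg t.size + 1)).sum =
      (rs.map (rootPot kind)).sum := rfl
    rw [h6] at h1
    have h7 := lg_nonneg m.size
    simp only [pot, List.map_cons, List.sum_cons] at *
    simp only [List.map_nil, List.sum_nil] at *
    simp only [rootPot] at *
    push_cast
    linarith

theorem size_meld (kind : Kind) (H H' : Heap K) : (H.meld kind H').val.size = H.size + H'.size := by
  have h1 := (emptyBuffer_spec kind H).1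
  have h1' := (emptyBuffer_spec kind H').1
  have h2 := buffer_emptyBuffer kind H
  have h2' := buffer_emptyBuffer kind H'
  simp only [meld, Timed.val_bind]
  rw [size_eq, h2] at h1
  rw [size_eq, h2'] at h1'
  simp only [List.map_nil, List.sum_nil, add_zero] at h1 h1'
  split_ifs
  · have h3 := ((catRoots_perm H.roots (H'.emptyBuffer kind).val.roots).map HTree.size).sum_eq
    simp only [Timed.val_bind, Timed.val_pure]
    rw [size_eq, size_eq H]
    simp only [h3, List.map_append, List.sum_append]
    omega
  · have h3 := ((catRoots_perm (H.emptyBuffer kind).val.roots H'.roots).map HTree.size).sum_eq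
    simp only [Timed.val_bind, Timed.val_pure]
    rw [size_eq, size_eq H']
    simp only [h3, List.map_append, List.sum_append]
    omega

theorem Balanced.meld {H H' : Heap K} (h : H.Balanced) (h' : H'.Balanced) (kind : Kind) :
    (H.meld kind H').val.Balanced := by
  have hs := size_meld kind H H'
  by_cases hle : H'.size ≤ H.size
  · exact h.of_le (by simp [Heap.meld, hle]) (by omega)
  · exact h'.of_le (by simp [Heap.meld, hle]) (by omega)

/-- The size at most doubles relative to the larger heap (plus one), so its logarithmic term grows
by at most 16. The term 16 lg(1 + n) of the smaller heap is released and pays for emptying its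
buffer. -/
theorem pot_meld_le (kind : Kind) (H H' : Heap K) :
    ((H.meld kind H').time : ℝ) + (H.meld kind H').val.pot kind ≤
      H.pot kind + H'.pot kind + 19 := by
  have hs := size_meld kind H H'
  unfold pot
  rw [hs]
  by_cases hle : H'.size ≤ H.size
  · have h1 := (emptyBuffer_spec kind H').2
    have h2 := time_catRoots_le H.roots (H'.emptyBuffer kind).val.roots
    have h3 := ((catRoots_perm H.roots (H'.emptyBuffer kind).val.roots).map
      (rootPot kind)).sum_eq
    have h4 := lg_mono (show 1 + (H.size + H'.size) ≤ 2 * (1 + H.size) by omega)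
    have h5 := lg_mono (show H'.size ≤ 1 + H'.size by omega)
    rw [lg_two_mul (by omega)] at h4
    have h2' : ((catRoots H.roots (H'.emptyBuffer kind).val.roots).time : ℝ) ≤ 2 := by
      exact_mod_cast h2
    have h6 : (0 : ℝ) ≤ H'.buffer.length := Nat.cast_nonneg _
    simp only [meld, hle, if_true, Timed.val_bind, Timed.time_bind, Timed.val_pure,
      Timed.time_pure, time_spend, h3, List.map_append, List.sum_append]
    push_cast
    linarith
  · have h1 := (emptyBuffer_spec kind H).2
    have h2 := time_catRoots_le (H.emptyBuffer kind).val.roots H'.roots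
    have h3 := ((catRoots_perm (H.emptyBuffer kind).val.roots H'.roots).map
      (rootPot kind)).sum_eq
    have h4 := lg_mono (show 1 + (H.size + H'.size) ≤ 2 * (1 + H'.size) by omega)
    have h5 := lg_mono (show H.size ≤ 1 + H.size by omega)
    rw [lg_two_mul (by omega)] at h4
    have h2' : ((catRoots (H.emptyBuffer kind).val.roots H'.roots).time : ℝ) ≤ 2 := by
      exact_mod_cast h2
    have h6 : (0 : ℝ) ≤ H.buffer.length := Nat.cast_nonneg _
    simp only [meld, hle, if_false, Timed.val_bind, Timed.time_bind, Timed.val_pure,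
      Timed.time_pure, time_spend, h3, List.map_append, List.sum_append]
    push_cast
    linarith

/-- In the costly case the potential rises by at most 2 lg lg n + 51 before any emptying, and 6
steps are spent besides; everything else is free because the cut does not raise the tree potentials.
-/
theorem decreaseKey_spec (kind : Kind) (x : ℕ) (k : WithBot K) {H : Heap K} (hH : H.Balanced) :
    (H.decreaseKey kind x k).val.Balanced ∧ (H.decreaseKey kind x k).val.size = H.size ∧
    ((H.decreaseKey kind x k).time : ℝ) + (H.decreaseKey kind x k).val.pot kind ≤
      H.pot kind + 59 * lglgBound H.size := by
  have hll := one_le_lglgBound H.size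
  by_cases hx : x ∈ H.roots.map HTree.id
  · have h1 := sum_map_lowerRoot HTree.size size_setKey x k H.roots
    have h2 := sum_map_lowerRoot (rootPot kind) (by simp [rootPot]) x k H.roots
    have h3 := time_lowerRoot x k H.roots
    have h4 : (H.decreaseKey kind x k).val.size = H.size := by
      simp [decreaseKey, hx, size_eq, h1]
    refine ⟨hH.of_le (by simp [decreaseKey, hx]) h4.ge, h4, ?_⟩
    rw [pot, h4, pot]
    simp only [decreaseKey, hx, if_true, Timed.val_bind, Timed.time_bind, Timed.val_pure,
      Timed.time_pure, time_spend, h2, h3]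
    push_cast
    linarith
  by_cases hx' : x ∈ H.buffer.map HTree.id
  · have h1 := sum_map_lowerRoot HTree.size size_setKey x k H.buffer
    have h2 := sum_map_lowerRoot (bufPot kind) (by simp) x k H.buffer
    have h3 := time_lowerRoot x k H.buffer
    have h5 := length_lowerRoot x k H.buffer
    have h4 : (H.decreaseKey kind x k).val.size = H.size := by
      simp [decreaseKey, hx, hx', size_eq, h1]
    refine ⟨hH.of_le (by simp [decreaseKey, hx, hx', h5]) h4.ge, h4, ?_⟩
    rw [pot, h4, pot]
    simp only [decreaseKey, hx, hx', if_true, if_false, Timed.val_bind, Timed.time_bind,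
      Timed.val_pure, Timed.time_pure, time_spend, h2, h3, h5]
    push_cast
    linarith
  simp only [decreaseKey, hx, hx', if_false, Timed.val_bind, Timed.time_bind, time_spend]
  rcases hc : H.cut x with _ | ⟨t, H₁⟩
  · refine ⟨hH, rfl, ?_⟩
    simp only [Timed.time_pure, Timed.val_pure]
    push_cast
    linarith
  obtain ⟨h1, h2, h3⟩ := cut_spec kind hx' hc
  simp only [Timed.val_bind, Timed.time_bind, time_spend]
  have h4 := insertRoot_perm (t.setKey k) H₁.buffer
  have h5 := time_insertRoot_le (t.setKey k) H₁.buffer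
  generalize (insertRoot (t.setKey k) H₁.buffer).time = T at *
  generalize (insertRoot (t.setKey k) H₁.buffer).val = bs at *
  have h6 := (h4.map HTree.size).sum_eq
  have h7 := (h4.map (bufPot kind)).sum_eq
  have h8 := h4.length_eq
  simp only [List.map_cons, List.sum_cons, size_setKey, bufPot_setKey, List.length_cons, h2]
    at h6 h7 h8
  have hsize : Heap.size (⟨H₁.roots, bs⟩ : Heap K) = H.size := by
    rw [← h3, size_eq, size_eq H₁]
    simp only [h6]
    omega
  have hcredit := bufCredit_succ_le H.buffer.length
  have hlglg : lg (H.buffer.length + 1) ≤ 1 + lglgBound H.size := by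
    refine lg_succ_le_lglgBound (hH.imp_left fun h => by simp [h])
  have hT : (T : ℝ) ≤ 2 := by exact_mod_cast h5
  have hpot : pot kind (⟨H₁.roots, bs⟩ : Heap K) ≤ H.pot kind + 2 * lglgBound H.size + 51 := by
    simp only [pot, hsize, h7, h8]
    linarith
  split_ifs with hb
  · have h9 := pot_emptyBuffer_le kind (⟨H₁.roots, bs⟩ : Heap K)
    have h10 := (emptyBuffer_spec kind (⟨H₁.roots, bs⟩ : Heap K)).1
    refine ⟨.inl (buffer_emptyBuffer _ _), h10.trans hsize, ?_⟩
    -- The buffer is full, so its surplus covers the whole logarithmic cost of emptying it.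
    have h11 : lg H.size ≤ bs.length := by
      refine (lg_mono hb).trans_eq ?_
      simp [lg, Real.logb_pow]
    rw [hsize] at h9
    push_cast
    simp only at h9
    linarith
  · refine ⟨.inr ?_, hsize, ?_⟩
    · rw [Timed.val_pure, hsize]
      exact not_le.1 hb
    · simp only [Timed.time_pure, Timed.val_pure]
      push_cast
      linarith

theorem buffer_delete (kind : Kind) (x : ℕ) (H : Heap K) :
    (H.delete kind x).val.buffer = [] := by
  simp only [delete, Timed.val_bind]
  split_ifs <;> simp [buffer_deleteMin]

theorem pot_deleteMin_le_lgBound (kind : Kind) (H : Heap K) :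
    ((H.deleteMin kind).time : ℝ) + (H.deleteMin kind).val.pot kind ≤
      H.pot kind + 194 * lgBound H.size := by
  have h1 := pot_deleteMin_le kind H
  have h2 := lg_le_lgBound H.size
  have h3 := one_le_lgBound H.size
  linarith

/-- 255 = 2 + 59 + 194: find-min, decrease-key, which preserves the size, and delete-min. This is
the constant of the theorem. -/
theorem pot_delete_le (kind : Kind) (x : ℕ) {H : Heap K} (hH : H.Balanced) :
    ((H.delete kind x).time : ℝ) + (H.delete kind x).val.pot kind ≤
      H.pot kind + 255 * lgBound H.size := by
  have h1 : (H.findMin.time : ℝ) ≤ 2 := by exact_mod_cast time_findMin_le H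
  have h2 := one_le_lgBound H.size
  have h3 := lglgBound_le_lgBound H.size
  simp only [delete, Timed.val_bind, Timed.time_bind]
  split_ifs
  · have h4 := pot_deleteMin_le_lgBound kind H
    push_cast
    linarith
  · obtain ⟨-, h4, h5⟩ := decreaseKey_spec kind x ⊥ hH
    have h6 := pot_deleteMin_le_lgBound kind (H.decreaseKey kind x ⊥).val
    rw [h4] at h6
    simp only [Timed.val_bind, Timed.time_bind]
    push_cast
    linarith

end Heap

end SelfAdjustingHeap

namespace SelfAdjustingHeap

/-! ### Collections of heaps -/

theorem finsum_update {ι : Type} [DecidableEq ι] (f : ι → ℝ) (hf : f.support.Finite) (i : ι)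
    (a : ℝ) : ∑ᶠ j, Function.update f i a j = (∑ᶠ j, f j) + (a - f i) := by
  have h : Function.update f i a = fun j => f j + (Pi.single i (a - f i) : ι → ℝ) j := by
    funext j
    rcases eq_or_ne j i with rfl | hj <;> simp [*]
  rw [h, finsum_add_distrib hf, finsum_eq_single (Pi.single i (a - f i) : ι → ℝ) i]
  · simp
  · intro j hj
    simp [hj]
  · exact (Set.finite_singleton i).subset Pi.support_single_subset

namespace State

variable {K : Type}

/-- The potential of the heap with a given name. -/
noncomputable def heapPot (kind : Kind) (s : State K) (h : ℕ) : ℝ := (s h).elim 0 (Heap.pot kind)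

/-- The potential of a collection of heaps. -/
noncomputable def pot (kind : Kind) (s : State K) : ℝ := ∑ᶠ h, s.heapPot kind h

/-- A finite collection of balanced heaps. -/
def Good (s : State K) : Prop := {h | s h ≠ none}.Finite ∧ ∀ h H, s h = some H → H.Balanced

theorem heapPot_nonneg (kind : Kind) (s : State K) (h : ℕ) : 0 ≤ s.heapPot kind h := by
  unfold heapPot
  cases s h
  · simp
  · exact Heap.pot_nonneg kind _

theorem pot_nonneg (kind : Kind) (s : State K) : 0 ≤ s.pot kind :=
  finsum_nonneg (s.heapPot_nonneg kind)

theorem pot_init (kind : Kind) : (State.init K).pot kind = 0 := by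
  simp [pot, heapPot, init]

theorem good_init : (State.init K).Good := by
  simp [Good, init]

theorem Good.pot_update {s : State K} (hs : s.Good) (kind : Kind) (h : ℕ) (X : Option (Heap K)) :
    State.pot kind (Function.update s h X) =
      s.pot kind + (X.elim 0 (Heap.pot kind) - s.heapPot kind h) := by
  have h1 : State.heapPot kind (Function.update s h X) =
      Function.update (s.heapPot kind) h (X.elim 0 (Heap.pot kind)) := by
    funext j
    rcases eq_or_ne j h with rfl | hj <;> simp [heapPot, *]
  rw [pot, h1, finsum_update]
  · rfl
  · refine hs.1.subset fun j hj hj' => hj ?_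
    simp [heapPot, hj']

theorem Good.update {s : State K} (hs : s.Good) (h : ℕ) (X : Option (Heap K))
    (hX : ∀ H, X = some H → H.Balanced) : State.Good (Function.update s h X) := by
  refine ⟨(hs.1.union (Set.finite_singleton h)).subset fun j hj => ?_, fun j H hj => ?_⟩
  · rcases eq_or_ne j h with rfl | hne
    · exact .inr rfl
    · exact .inl (by simpa [hne] using hj)
  · rcases eq_or_ne j h with rfl | hne
    · exact hX H (by simpa using hj)
    · exact hs.2 j H (by simpa [hne] using hj)

variable [LinearOrder K]

theorem Good.step {s s' : State K} (hs : s.Good) {kind : Kind} {op : Op K} {t : ℕ}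
    (h : Step kind s op t s') :
    s'.Good ∧ (t : ℝ) + s'.pot kind - s.pot kind ≤ 255 * op.bound s := by
  cases h with
  | makeHeap h hh =>
    refine ⟨hs.update _ _ ?_, ?_⟩
    · rintro H ⟨⟩
      exact .inl rfl
    · rw [hs.pot_update]
      simp [heapPot, hh, Heap.make, Heap.pot, Heap.size_eq, bufCredit, lg_one, Op.bound]
  | findMin h H hh =>
    refine ⟨hs, ?_⟩
    have : (H.findMin.time : ℝ) ≤ 2 := by exact_mod_cast H.time_findMin_le
    simp only [Op.bound]
    linarith
  | insert x k h H hh hx =>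
    refine ⟨hs.update _ _ ?_, ?_⟩
    · rintro G ⟨⟩
      exact (hs.2 h H hh).of_le (by simp [Heap.insert]) (by rw [Heap.size_insert]; omega)
    · rw [hs.pot_update]
      have h1 : ((H.insert x k).time : ℝ) ≤ 3 := by exact_mod_cast H.time_insert_le x k
      have h2 := H.pot_insert_le kind x k
      simp only [heapPot, hh, Option.elim_some, Op.bound]
      linarith
  | deleteMin h H hh =>
    refine ⟨hs.update _ _ ?_, ?_⟩
    · rintro G ⟨⟩
      exact .inl (H.buffer_deleteMin kind)
    · rw [hs.pot_update]
      have h1 := H.pot_deleteMin_le_lgBound kind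
      have h2 := one_le_lgBound H.size
      simp only [heapPot, State.size, hh, Option.elim_some, Op.bound]
      linarith
  | meld h h' H H' hne hh hh' =>
    have hs' := hs.update h' none (by simp)
    refine ⟨hs'.update _ _ ?_, ?_⟩
    · rintro G ⟨⟩
      exact (hs.2 h H hh).meld (hs.2 h' H' hh') kind
    · rw [hs'.pot_update, hs.pot_update]
      have h1 := H.pot_meld_le kind H'
      simp only [heapPot, hh, hh', hne, ne_eq, not_false_eq_true, Function.update_of_ne,
        Option.elim_some, Option.elim_none, Op.bound]
      linarith
  | decreaseKey x k h H hh c hx hk =>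
    obtain ⟨h1, -, h2⟩ := H.decreaseKey_spec kind x k (hs.2 h H hh)
    refine ⟨hs.update _ _ ?_, ?_⟩
    · rintro G ⟨⟩
      exact h1
    · rw [hs.pot_update]
      have h3 := one_le_lglgBound H.size
      simp only [heapPot, State.size, hh, Option.elim_some, Op.bound]
      linarith
  | delete x h H hh c hx =>
    refine ⟨hs.update _ _ ?_, ?_⟩
    · rintro G ⟨⟩
      exact .inl (H.buffer_delete kind x)
    · rw [hs.pot_update]
      have h1 := H.pot_delete_le kind x (hs.2 h H hh)
      simp only [heapPot, State.size, hh, Option.elim_some, Op.bound]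
      linarith

end State

-- Sequences of operations and the theorem

variable {K : Type} [LinearOrder K]

/-- The amortized inequalities telescope, and `State.Good` is carried along since decrease-key is
cheap only while buffers are short. -/
theorem Run.good {kind : Kind} {s : State K} {T : ℕ} {B : ℝ} (h : Run kind s T B) :
    s.Good ∧ (T : ℝ) + s.pot kind ≤ 255 * B := by
  induction h with
  | nil => exact ⟨State.good_init, by simp [State.pot_init]⟩
  | snoc s T B op t s' _ hstep ih =>
    obtain ⟨h1, h2⟩ := ih.1.step hstep
    refine ⟨h1, ?_⟩
    have := ih.2
    push_cast
    linarith

end SelfAdjustingHeap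

theorem theorem1 :
    ∃ C : ℝ, ∀ kind : Kind,
      -- the amortized times, by means of a potential
      (∃ Φ : State ℝ → ℝ, Φ (State.init ℝ) = 0 ∧ (∀ s, Reachable kind s → 0 ≤ Φ s) ∧
        ∀ s op t s', Reachable kind s → Step kind s op t s' →
          (t : ℝ) + Φ s' - Φ s ≤ C * op.bound s) ∧
      -- the total actual time of any sequence of operations
      (∀ (s : State ℝ) (T : ℕ) (B : ℝ), Run kind s T B → (T : ℝ) ≤ C * B) ∧
      -- the worst-case times of make-heap, find-min and insert
      (∀ (s : State ℝ) (op : Op ℝ) (t : ℕ) (s' : State ℝ), Step kind s op t s' →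
        ((∃ h, op = .makeHeap h) ∨ (∃ h, op = .findMin h) ∨ (∃ x k h, op = .insert x k h)) →
          (t : ℝ) ≤ C) := by
  refine ⟨255, fun kind => ⟨⟨State.pot kind, State.pot_init kind,
    fun s _ => s.pot_nonneg kind, ?_⟩, ?_, ?_⟩⟩
  · rintro s op t s' ⟨T, B, hrun⟩ hstep
    exact (hrun.good.1.step hstep).2
  · intro s T B hrun
    have h1 := hrun.good.2
    have h2 := s.pot_nonneg kind
    linarith
  · intro s op t s' hstep hop
    have ht : t ≤ 3 := by
      cases hstep with
      | makeHeap h hh => simp [Heap.make]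
      | findMin h H hh => exact H.time_findMin_le.trans (by norm_num)
      | insert x k h H hh hx => exact H.time_insert_le x k
      | deleteMin | meld | decreaseKey | delete => simp at hop
    have : (t : ℝ) ≤ 3 := by exact_mod_cast ht
    linarith
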